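/- **Setting.** Let $n,m\ge 1$, let $N_0=\{1,\dots,n\}$ be the buyers, $M=\{1,\dots,m\}$ the sellers, and $E\subseteq N_0\times M$ a set of edges. Write $E_i$, $E_j$ for the edges at buyer $i$, resp. seller $j$, and $E_S$ for the edges at a set $S$ of buyers. For each $j\in M$ let $f_j:2^{E_j}\to\mathbb R_+$ be monotone and submodular with $f_j(\emptyset)=0$. A transaction vector $w\in\mathbb R_+^{E}$ is feasible if $w(F)\le f_j(F)$ for all $j\in M$, $F\subseteq E_j$. Buyers have valuations $v_i>0$ and budgets $B_i\in[0,\infty]$; sellers have valuations $\rho_j>0$. All bids are truthful, and all $v_i$ and $\rho_j$ are integer multiples of a number $\varepsilon>0$. An allocation $(w,p,r)$ consists of a feasible $w$, payments $0\le p_i\le B_i$ of the buyers and revenues $r_j\ge0$ of the sellers. Its social welfare and liquid welfare are $$\mathrm{SW}=\sum_{i\in N_0}v_i\,w(E_i)+\sum_{j\in M}\rho_j\bigl(f_j(E_j)-w(E_j)\bigr),\qquad \mathrm{LW}=\sum_{i\in N_0}\min\bigl(v_i\,w(E_i),B_i\bigr)+\sum_{j\in M}\rho_j\bigl(f_j(E_j)-w(E_j)\bigr).$$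 **Modified market.** For each $j\in M$ add a virtual buyer $n+j$ adjacent to seller $j$ only, with $v_{n+j}=\rho_j$ and $B_{n+j}=\infty$; a set of edges at $j$ containing the edge of $n+j$ gets the value $f_j(E_j)$ (with the original $E_j$). From now on $N=\{1,\dots,n+m\}$, and $E$, $f_j$ and the polytope $P$ of feasible transaction vectors refer to this market; put $f(S)=\sum_{j}f_j(S\cap E_j)$ for $S\subseteq E$. **Greedy vector.** For $i\in N$ let $H_i$ be the set of $k\in N$ with $v_k>v_i$, or with $v_k=v_i$ and $k<i$. Define $x^*\in\mathbb R^N$ recursively by $$x^*_i=\min\Bigl(\frac{B_i}{v_i},\ \min_{H\subseteq H_i}\bigl\{f(E_{H\cup\{i\}})-x^*(H)\bigr\}\Bigr).$$ **Polyhedral Clinching Auction.** Start with $w=0$, $p=0$, $r=0$, clocks $c_i=0$ for $i\in N$, and $l=1$. The demand of $i$ is always $d_i=\infty$ if $c_i=0$, $d_i=(B_i-p_i)/c_i$ if $0<c_i<v_i$, and $d_i=0$ otherwise. Let $P_{w,d}=\{y\in\mathbb R_+^E: w+y\in P,\ y(E_i)\le d_i\ (i\in N)\}$, and for $\xi\in\mathbb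 R_+^{E_i}$ let $P^i_{w,d}(\xi)$ be the set of all vectors $(y(E_k))_{k\in N\setminus\{i\}}$ with $y\in P_{w,d}$ and $y|_{E_i}=\xi$. While some $d_i\ne0$, repeat: 1. for $i=1,\dots,n+m$ in turn, choose a maximal $\xi\in\mathbb R_+^{E_i}$ (in the coordinatewise order) with $P^i_{w,d}(\xi)=P^i_{w,d}(0)$, increase $w|_{E_i}$ by $\xi$, $p_i$ by $c_i\,\xi(E_i)$ and each $r_j$ by $c_i\,\xi_{ij}$, and update $d_i$; 2. increase $c_l$ by $\varepsilon$, and let $l$ move to the next buyer cyclically. For a terminal state $(w,p,r)$, let $x^{\rm f}_i=w(E_i)$ for $i\in N$. The mechanism outputs the allocation of the original market obtained by canceling the transactions of the virtual buyers: $w$ restricted to the edges of non-virtual buyers, $p_i$ for $i\in N_0$, and $r_j-p_{n+j}$ for $j\in M$. Let $\mathrm{SW}^{\rm PCA}$ be the social welfare of this output, and let $\mathrm{LW}^{\rm OPT}$ be the maximum of $\mathrm{LW}$ over all allocations of the original market. **Theorem 3.10.** The maximum $\mathrm{LW}^{\rm OPT}$ is attained, the auction has at least one terminal state, and in every terminal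 state that can be reached (whatever maximal vectors are chosen), $$\mathrm{SW}^{\rm PCA}=\sum_{i\in N}v_i x^{\rm f}_i\ \ge\ \sum_{i\in N}v_i x^*_i=\mathrm{LW}^{\rm OPT}.$$ -/

import Mathlib

open scoped ENNReal

noncomputable section

/-- A market with buyers `Fin n`, sellers `Fin m`, a set `E` of edges (pairs buyer, seller), and
for each seller `j` a set function `f j`, of which only the values on subsets of the set `E_j` of
edges at `j` are meaningful. -/
structure Market (n m : ℕ) where
  E : Finset (Fin n × Fin m)
  f : Fin m → Finset (Fin n × Fin m) → ℝ

namespace Market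

variable {n m : ℕ}

/-- The set `E_i` of edges at buyer `i`. -/
def buyerEdges (G : Market n m) (i : Fin n) : Finset (Fin n × Fin m) :=
  G.E.filter (fun e => e.1 = i)

/-- The set `E_j` of edges at seller `j`. -/
def sellerEdges (G : Market n m) (j : Fin m) : Finset (Fin n × Fin m) :=
  G.E.filter (fun e => e.2 = j)

/-- The set `E_S` of edges at a set `S` of buyers. -/
def edgesOf (G : Market n m) (S : Finset (Fin n)) : Finset (Fin n × Fin m) :=
  G.E.filter (fun e => e.1 ∈ S)

/-- Each `f j` is a normalized, monotone, submodular function on the subsets of `E_j`,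
that is, the rank function of a polymatroid on `E_j`. -/
structure IsPolymatroidal (G : Market n m) : Prop where
  empty : ∀ j, G.f j ∅ = 0
  mono : ∀ j, ∀ F F' : Finset (Fin n × Fin m), F ⊆ F' → F' ⊆ G.sellerEdges j →
    G.f j F ≤ G.f j F'
  submodular : ∀ j, ∀ F F' : Finset (Fin n × Fin m), F ⊆ G.sellerEdges j →
    F' ⊆ G.sellerEdges j → G.f j (F ∪ F') + G.f j (F ∩ F') ≤ G.f j F + G.f j F'

/-- The function `f(S) = ∑_j f_j(S ∩ E_j)` on sets `S` of edges. -/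
def totalF (G : Market n m) (S : Finset (Fin n × Fin m)) : ℝ :=
  ∑ j, G.f j (S ∩ G.sellerEdges j)

/-- The polytope `P` of feasible transaction vectors. A vector indexed by `E` is represented by a
function on all pairs that vanishes outside `E`. -/
def polytope (G : Market n m) : Set (Fin n × Fin m → ℝ) :=
  {w | (∀ e, 0 ≤ w e) ∧ (∀ e, e ∉ G.E → w e = 0) ∧
    ∀ j, ∀ F ⊆ G.sellerEdges j, ∑ e ∈ F, w e ≤ G.f j F}

/-- The amount `w(E_i)` of goods that buyer `i` obtains under `w`. -/
def amount (G : Market n m) (w : Fin n × Fin m → ℝ) (i : Fin n) : ℝ :=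
  ∑ e ∈ G.buyerEdges i, w e

/-- The amount `f_j(E_j) - w(E_j)` of goods that seller `j` keeps under `w`. -/
def unsold (G : Market n m) (w : Fin n × Fin m → ℝ) (j : Fin m) : ℝ :=
  G.f j (G.sellerEdges j) - ∑ e ∈ G.sellerEdges j, w e

/-- The remnant supply polytope `P_{w,d}`. -/
def remnant (G : Market n m) (w : Fin n × Fin m → ℝ) (d : Fin n → ℝ≥0∞) :
    Set (Fin n × Fin m → ℝ) :=
  {y | (∀ e, 0 ≤ y e) ∧ (∀ e, e ∉ G.E → y e = 0) ∧ w + y ∈ G.polytope ∧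
    ∀ i, ENNReal.ofReal (G.amount y i) ≤ d i}

/-- The set `P^i_{w,d}(ξ)` of possible future transactions of the buyers other than `i`
if buyer `i` transacts `ξ`. -/
def othersFuture (G : Market n m) (w : Fin n × Fin m → ℝ) (d : Fin n → ℝ≥0∞) (i : Fin n)
    (ξ : Fin m → ℝ) : Set ({k : Fin n // k ≠ i} → ℝ) :=
  {u | (∀ k, 0 ≤ u k) ∧ ∃ y ∈ G.remnant w d,
    (∀ e ∈ G.buyerEdges i, y e = ξ e.2) ∧ ∀ k : {k : Fin n // k ≠ i}, G.amount y k = u k}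

/-- The clinching polytope `P^i_{w,d}`; again a vector indexed by `E_i` is represented by a
function on all sellers that vanishes outside the neighbours of `i`. -/
def clinchingPolytope (G : Market n m) (w : Fin n × Fin m → ℝ) (d : Fin n → ℝ≥0∞) (i : Fin n) :
    Set (Fin m → ℝ) :=
  {ξ | (∀ j, 0 ≤ ξ j) ∧ (∀ j, (i, j) ∉ G.E → ξ j = 0) ∧
    G.othersFuture w d i ξ = G.othersFuture w d i 0}

/-- Preprocessing: the market with a virtual buyer `n + j`, adjacent to `j` only, added for each
seller `j`. A set of edges that contains the virtual edge of `j` gets the value `f_j(E_j)`. -/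
def withVirtual (G : Market n m) : Market (n + m) m where
  E := G.E.image (fun e => (Fin.castAdd m e.1, e.2)) ∪
    Finset.univ.image (fun j => (Fin.natAdd n j, j))
  f := fun j F =>
    if (Fin.natAdd n j, j) ∈ F then G.f j (G.sellerEdges j)
    else G.f j (G.E.filter (fun e => (Fin.castAdd m e.1, e.2) ∈ F))

end Market

/-- An allocation: transactions `w`, payments `p` of the buyers, revenues `r` of the sellers. -/
structure Allocation (n m : ℕ) where
  w : Fin n × Fin m → ℝ
  p : Fin n → ℝ
  r : Fin m → ℝ

/-- The minimum of a real number and a possibly infinite bound. -/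
def capAt (a : ℝ) (b : ℝ≥0∞) : ℝ := if b = ⊤ then a else min a b.toReal

/-- Polymatroid and budget constraints on an allocation. -/
def Allocation.IsFeasible {n m : ℕ} (G : Market n m) (B : Fin n → ℝ≥0∞)
    (A : Allocation n m) : Prop :=
  A.w ∈ G.polytope ∧ (∀ i, 0 ≤ A.p i ∧ ENNReal.ofReal (A.p i) ≤ B i) ∧ ∀ j, 0 ≤ A.r j

/-- Social welfare of an allocation of the two-sided market. -/
def socialWelfare {n m : ℕ} (G : Market n m) (v : Fin n → ℝ) (ρ : Fin m → ℝ)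
    (A : Allocation n m) : ℝ :=
  ∑ i, v i * G.amount A.w i + ∑ j, ρ j * G.unsold A.w j

/-- Liquid welfare of an allocation of the two-sided market. -/
def liquidWelfare {n m : ℕ} (G : Market n m) (v : Fin n → ℝ) (ρ : Fin m → ℝ)
    (B : Fin n → ℝ≥0∞) (A : Allocation n m) : ℝ :=
  ∑ i, capAt (v i * G.amount A.w i) (B i) + ∑ j, ρ j * G.unsold A.w j

/-! ### The greedy vector -/

/-- The set `H_i`: buyers of higher valuation than `i`, and buyers of the same valuation
that are numbered before `i`. -/
def higher {N : ℕ} (v : Fin N → ℝ) (i : Fin N) : Finset (Fin N) :=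
  Finset.univ.filter (fun k => v i < v k ∨ (v k = v i ∧ k < i))

theorem higher_card_lt {N : ℕ} (v : Fin N → ℝ) {i k : Fin N} (h : k ∈ higher v i) :
    (higher v k).card < (higher v i).card := by
  have h' : v i < v k ∨ (v k = v i ∧ k < i) := by simpa [higher] using h
  apply Finset.card_lt_card
  rw [Finset.ssubset_iff_of_subset]
  · exact ⟨k, h, by simp [higher]⟩
  · intro a ha
    have ha' : v k < v a ∨ (v a = v k ∧ a < k) := by simpa [higher] using ha
    have : v i < v a ∨ (v a = v i ∧ a < i) := by
      rcases h' with h1 | ⟨h1, h2⟩ <;> rcases ha' with h3 | ⟨h3, h4⟩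
      · exact Or.inl (h1.trans h3)
      · exact Or.inl (h3 ▸ h1)
      · exact Or.inl (h1 ▸ h3)
      · exact Or.inr ⟨h3.trans h1, h4.trans h2⟩
    simpa [higher] using this

/-- The vector `x*` given recursively by
`x*_i = min (B_i / v_i) (min_{H ⊆ H_i} (f(E_{H ∪ i}) - x*(H)))`. -/
def greedy {N m : ℕ} (G : Market N m) (v : Fin N → ℝ) (B : Fin N → ℝ≥0∞) (i : Fin N) : ℝ :=
  capAt
    ((higher v i).powerset.attach.inf' ⟨⟨∅, by simp⟩, Finset.mem_attach _ _⟩ (fun H =>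
      G.totalF (G.edgesOf (insert i H.1)) - ∑ k ∈ H.1.attach, greedy G v B k.1))
    (B i / ENNReal.ofReal (v i))
termination_by (higher v i).card
decreasing_by exact higher_card_lt v (Finset.mem_powerset.1 H.2 k.2)

theorem greedy_eq {N m : ℕ} (G : Market N m) (v : Fin N → ℝ) (B : Fin N → ℝ≥0∞) (i : Fin N) :
    greedy G v B i = capAt
      ((higher v i).powerset.inf' ⟨∅, by simp⟩ (fun H =>
        G.totalF (G.edgesOf (insert i H)) - ∑ k ∈ H, greedy G v B k))
      (B i / ENNReal.ofReal (v i)) := by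
  rw [greedy]
  congr 1
  apply le_antisymm
  · refine Finset.le_inf' _ _ (fun H hH => ?_)
    refine (Finset.inf'_le _ (Finset.mem_attach _ ⟨H, hH⟩)).trans (le_of_eq ?_)
    simp only [Finset.sum_attach H (fun k => greedy G v B k)]
  · refine Finset.le_inf' _ _ (fun H _ => ?_)
    refine (Finset.inf'_le _ H.2).trans (le_of_eq ?_)
    simp only [Finset.sum_attach H.1 (fun k => greedy G v B k)]

/-! ### The auction in a market whose buyers `0, …, N-1` include the virtual ones -/

/-- A state of the auction: price clocks `c`, payments `p`, revenues `r`, transactions `w`,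
and the buyer `l` whose clock is to be raised next. -/
structure AuctionState (N m : ℕ) where
  c : Fin N → ℝ
  p : Fin N → ℝ
  r : Fin m → ℝ
  w : Fin N × Fin m → ℝ
  l : ℕ

namespace AuctionState

variable {N m : ℕ}

/-- The initial state. -/
def init : AuctionState N m where
  c := 0
  p := 0
  r := 0
  w := 0
  l := 0

/-- The demand `d_i`: infinite while the clock is still at `0`, then `(B_i - p_i) / c_i` as long
as `c_i` is below the bid `v_i`, and `0` afterwards. (Every assignment to `d_i` in the auction is
of this form, so the demands need not be stored.) -/
def demand (v : Fin N → ℝ) (B : Fin N → ℝ≥0∞) (s : AuctionState N m) (i : Fin N) : ℝ≥0∞ :=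
  if s.c i = 0 then ⊤
  else if s.c i < v i then (B i - ENNReal.ofReal (s.p i)) / ENNReal.ofReal (s.c i)
  else 0

/-- Update when buyer `i` buys `ξ j` from each seller `j` at the unit price `c_i`. -/
def buy (s : AuctionState N m) (i : Fin N) (ξ : Fin m → ℝ) : AuctionState N m where
  c := s.c
  p := Function.update s.p i (s.p i + s.c i * ∑ j, ξ j)
  r := fun j => s.r j + s.c i * ξ j
  w := fun e => if e.1 = i then s.w e + ξ e.2 else s.w e
  l := s.l

/-- Buyer `i` clinches some maximal vector of her clinching polytope. -/
def Clinch (G : Market N m) (v : Fin N → ℝ) (B : Fin N → ℝ≥0∞) (i : Fin N)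
    (s s' : AuctionState N m) : Prop :=
  ∃ ξ : Fin m → ℝ, Maximal (· ∈ G.clinchingPolytope s.w (s.demand v B) i) ξ ∧ s' = s.buy i ξ

/-- The buyers in a list clinch one after another. -/
def ClinchList (G : Market N m) (v : Fin N → ℝ) (B : Fin N → ℝ≥0∞) :
    List (Fin N) → AuctionState N m → AuctionState N m → Prop
  | [], s, s' => s' = s
  | i :: L, s, s' => ∃ t, Clinch G v B i s t ∧ ClinchList G v B L t s'

/-- The clock of buyer `l` is raised by `ε`, and `l` moves on cyclically. -/
def tick (ε : ℝ) (s : AuctionState N m) : AuctionState N m where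
  c := fun i => if (i : ℕ) = s.l then s.c i + ε else s.c i
  p := s.p
  r := s.r
  w := s.w
  l := (s.l + 1) % N

/-- One pass through the body of the main loop, entered only if some demand is nonzero. -/
def Iteration (G : Market N m) (v : Fin N → ℝ) (B : Fin N → ℝ≥0∞) (ε : ℝ)
    (s s' : AuctionState N m) : Prop :=
  (∃ i, s.demand v B i ≠ 0) ∧
    ∃ t, ClinchList G v B (List.finRange N) s t ∧ s' = t.tick ε

/-- `s` is a state in which the main loop can end (several may exist, because maximal clinching
vectors need not be unique). -/
def IsTerminal (G : Market N m) (v : Fin N → ℝ) (B : Fin N → ℝ≥0∞) (ε : ℝ)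
    (s : AuctionState N m) : Prop :=
  Relation.ReflTransGen (Iteration G v B ε) init s ∧ ∀ i, s.demand v B i = 0

end AuctionState

/-! ### The Polyhedral Clinching Auction for a two-sided market -/

/-- Valuations (or bids) of the buyers of the modified market: `v_{n+j} = ρ_j`. -/
def extVal {n m : ℕ} (v : Fin n → ℝ) (ρ : Fin m → ℝ) : Fin (n + m) → ℝ := Fin.append v ρ

/-- Budgets of the buyers of the modified market: `B_{n+j} = ∞`. -/
def extBudget {n : ℕ} (m : ℕ) (B : Fin n → ℝ≥0∞) : Fin (n + m) → ℝ≥0∞ :=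
  Fin.append B (fun _ : Fin m => ⊤)

/-- `s` is a possible state at the end of the main loop of the Polyhedral Clinching Auction with
bids `v` of the buyers and `ρ` of the sellers. -/
def IsPCATerminal {n m : ℕ} (G : Market n m) (v : Fin n → ℝ) (ρ : Fin m → ℝ)
    (B : Fin n → ℝ≥0∞) (ε : ℝ) (s : AuctionState (n + m) m) : Prop :=
  AuctionState.IsTerminal G.withVirtual (extVal v ρ) (extBudget m B) ε s

/-- The allocation that the mechanism outputs from its terminal state, by canceling the
transactions of the virtual buyers. -/
def AuctionState.output {n m : ℕ} (s : AuctionState (n + m) m) : Allocation n m where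
  w := fun e => s.w (Fin.castAdd m e.1, e.2)
  p := fun i => s.p (Fin.castAdd m i)
  r := fun j => s.r j - s.p (Fin.natAdd n j)

end

/-!
Aggregate the transactions to the vector `x` of the amounts that the buyers obtain. Splitting up
the blocks of a partition one element at a time (`exists_split`) shows that amounts are feasible if
and only if `x(T) ≤ f(E_T)` for all groups `T` of buyers, that is, they form a polymatroid.

*Optimal liquid welfare.* Capping amounts at `B_i / v_i` and letting virtual buyers take unsold
goods turns liquid welfare into a linear function on the part of this polymatroid below the caps.
Each coordinate of `x*` is at its cap or in a tight set of buyers that come no later in the greedy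
order. Uncrossing these tight sets (`sum_le_sum_of_tight`) shows that `x*` has the largest total on
each set `{i | t ≤ v_i}`, and summing over the levels `t` shows that `x*` is optimal.

*The auction.* The same criterion is applied to the final amounts. Three facts carry the argument.
* What the buyers may still obtain depends only on the amounts obtained so far (`Aggregated`).
* After a maximal clinch of `i`, all remaining goods can be sold without `i` (`Sellable.without`):
  each edge of `i` that admits no clinch lies in a set of edges which the other buyers can buy up,
  and these sets are uncrossed. So everything is sold in the end.
* If `k` clinches a positive amount, the others cannot buy everything. A tight set `T` of a largest
  future of the others does not contain `k`, and after the clinch the demands outside `T` and `k`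
  just absorb what is not left for `T` (`Cert`). This persists, and once `k` has no demand, every
  buyer outside `T` must have clinched all of her demand (`Cert.demand_eq_zero`).

Hence in a terminal state each buyer `k` with positive amount has a tight set `T` not containing
`k`, outside of which all buyers of higher valuation have exhausted their budgets. For a level `t`,
intersect the sets `T` belonging to the `k` with `v_k < t` and discard the buyers with `v_i < t`,
whose amounts in the intersection vanish. The result is a tight set of buyers with `t ≤ v_i` that
contains every such buyer with money left, and a buyer without money left has obtained at least
`B_i / v_i`, since she never paid more than `v_i` per unit.
-/

noncomputable section

/-! ### Submodular functions and vectors below them -/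

section Submodular

variable {α K : Type*}

theorem exists_pos_le_of_finite {ι : Type*} [Finite ι] (g : ι → ℝ) (hg : ∀ p, 0 < g p) :
    ∃ κ > 0, ∀ p, κ ≤ g p := by
  cases isEmpty_or_nonempty ι
  · exact ⟨1, one_pos, fun p => isEmptyElim p⟩
  · obtain ⟨p, hp⟩ := Finite.exists_min g
    exact ⟨g p, hg p, hp⟩

theorem sum_update_sub [DecidableEq K] (u : K → ℝ) (S : Finset K) (k : K) (a : ℝ) :
    ∑ j ∈ S, Function.update u k (u k - a) j = ∑ j ∈ S, u j - if k ∈ S then a else 0 := by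
  split_ifs with h
  · rw [Finset.sum_update_of_mem h, ← Finset.sum_sdiff (Finset.singleton_subset_iff.2 h)]
    simp; ring
  · rw [Finset.sum_update_of_notMem h]; ring

theorem sum_update_add [DecidableEq K] (u : K → ℝ) (S : Finset K) (k : K) (a : ℝ) :
    ∑ j ∈ S, Function.update u k (u k + a) j = ∑ j ∈ S, u j + if k ∈ S then a else 0 := by
  have := sum_update_sub u S k (-a)
  rw [sub_neg_eq_add] at this
  rw [this]; split_ifs <;> ring

/-- One element `e₀` is split off its block with the largest share that the bounds allow; by
submodularity, the rest of the block then still respects the bounds on the sets avoiding `e₀`. -/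
theorem split_step [DecidableEq α] [DecidableEq K] [Fintype α] [Fintype K] (π : α → K)
    (h : Finset α → ℝ)
    (hsub : ∀ F F', h (F ∪ F') + h (F ∩ F') ≤ h F + h F') (U : Finset α) (e₀ : α) (he₀ : e₀ ∉ U)
    (y : α → ℝ) (z : K → ℝ) (hz : ∀ k, 0 ≤ z k)
    (hc : ∀ T F, (∀ e, e ∉ U → π e ∈ T → e ∈ F) → ∑ e ∈ F, y e + ∑ k ∈ T, z k ≤ h F) :
    ∃ a, 0 ≤ a ∧ a ≤ z (π e₀) ∧ ∀ T F, (∀ e, e ∉ insert e₀ U → π e ∈ T → e ∈ F) →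
      ∑ e ∈ F, Function.update y e₀ (y e₀ + a) e +
        ∑ k ∈ T, Function.update z (π e₀) (z (π e₀) - a) k ≤ h F := by
  classical
  set k₀ := π e₀ with hk₀
  let I := {p : Finset K × Finset α // (∀ e, e ∉ U → π e ∈ p.1 → e ∈ p.2) ∧ k₀ ∉ p.1 ∧ e₀ ∈ p.2}
  have : Nonempty I := ⟨⟨(∅, Finset.univ), by simp⟩⟩
  obtain ⟨⟨⟨T₁, F₁⟩, h₁, h₁k, h₁e⟩, hmin⟩ := Finite.exists_min
    (fun p : I => h p.1.2 - ∑ e ∈ p.1.2, y e - ∑ k ∈ p.1.1, z k)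
  dsimp only at hmin h₁ h₁k h₁e
  refine ⟨min (z k₀) (h F₁ - ∑ e ∈ F₁, y e - ∑ k ∈ T₁, z k), le_min (hz _) ?_, min_le_left _ _, ?_⟩
  · have := hc T₁ F₁ h₁
    linarith
  intro T F hTF
  rw [sum_update_add, sum_update_sub]
  by_cases hk : k₀ ∈ T <;> by_cases he : e₀ ∈ F <;> simp only [hk, he, if_true, if_false]
  · have := hc T F (fun e heU heT => by
      by_cases hee : e = e₀
      · exact hee ▸ he
      · exact hTF e (by simp [hee, heU]) heT)
    linarith
  · rcases min_choice (z k₀) (h F₁ - ∑ e ∈ F₁, y e - ∑ k ∈ T₁, z k) with hm | hm <;> rw [hm]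
    · have := hc (T.erase k₀) F (fun e heU heT => by
        have hee : e ≠ e₀ := by
          rintro rfl
          simp [← hk₀] at heT
        exact hTF e (by simp [hee, heU]) (Finset.mem_of_mem_erase heT))
      have h2 := Finset.add_sum_erase T z hk
      linarith
    · -- the pair attaining the minimum is uncrossed with the pair under consideration
      have ha := hc (T₁ ∪ T) (F₁ ∪ F) (fun e heU heT => by
        rcases Finset.mem_union.1 heT with h' | h'
        · exact Finset.mem_union_left _ (h₁ e heU h')
        · by_cases hee : e = e₀
          · exact Finset.mem_union_left _ (hee ▸ h₁e)
          · exact Finset.mem_union_right _ (hTF e (by simp [hee, heU]) h'))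
      have hb := hc (T₁ ∩ T) (F₁ ∩ F) (fun e heU heT => by
        obtain ⟨h', h''⟩ := Finset.mem_inter.1 heT
        have hee : e ≠ e₀ := by
          rintro rfl
          exact h₁k h'
        exact Finset.mem_inter.2 ⟨h₁ e heU h', hTF e (by simp [hee, heU]) h''⟩)
      have hs := hsub F₁ F
      have e1 := Finset.sum_union_inter (f := y) (s₁ := F₁) (s₂ := F)
      have e2 := Finset.sum_union_inter (f := z) (s₁ := T₁) (s₂ := T)
      linarith
  · have hv : ∀ e, e ∉ U → π e ∈ T → e ∈ F := fun e heU heT => by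
      by_cases hee : e = e₀
      · exact hee ▸ he
      · exact hTF e (by simp [hee, heU]) heT
    have := hmin ⟨(T, F), hv, hk, he⟩
    dsimp only at this
    have := min_le_right (z k₀) (h F₁ - ∑ e ∈ F₁, y e - ∑ k ∈ T₁, z k)
    linarith
  · have := hc T F (fun e heU heT => by
      have hee : e ≠ e₀ := by
        rintro rfl
        exact hk heT
      exact hTF e (by simp [hee, heU]) heT)
    linarith

/-- A vector `u` on the blocks of a partition that respects all the bounds `h F` for the sets `F`
covering a union of blocks is the vector of block sums of a vector below `h`. The blocks are
split up one element at a time. -/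
theorem exists_split [DecidableEq α] [DecidableEq K] [Fintype α] [Fintype K] (π : α → K)
    (h : Finset α → ℝ)
    (hsub : ∀ F F', h (F ∪ F') + h (F ∩ F') ≤ h F + h F') (h0 : h ∅ = 0)
    (u : K → ℝ) (hu : ∀ k, 0 ≤ u k)
    (hc : ∀ T F, (∀ e, π e ∈ T → e ∈ F) → ∑ k ∈ T, u k ≤ h F) :
    ∃ y : α → ℝ, (∀ e, 0 ≤ y e) ∧ (∀ F, ∑ e ∈ F, y e ≤ h F) ∧
      ∀ k, ∑ e with π e = k, y e = u k := by
  classical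
  have key : ∀ U : Finset α, ∃ (y : α → ℝ) (z : K → ℝ), (∀ e, 0 ≤ y e) ∧ (∀ e, e ∉ U → y e = 0) ∧
      (∀ k, 0 ≤ z k) ∧ (∀ k, ∑ e with π e = k, y e + z k = u k) ∧
      ∀ T F, (∀ e, e ∉ U → π e ∈ T → e ∈ F) → ∑ e ∈ F, y e + ∑ k ∈ T, z k ≤ h F := by
    intro U
    induction U using Finset.induction_on with
    | empty => exact ⟨0, u, by simp, by simp, hu, by simp, by simpa using hc⟩
    | insert e₀ U he₀ ih =>
      obtain ⟨y, z, hy, hyU, hz, hs, hc'⟩ := ih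
      obtain ⟨a, ha, haz, hac⟩ := split_step π h hsub U e₀ he₀ y z hz hc'
      refine ⟨_, _, ?_, ?_, ?_, ?_, hac⟩
      · intro e
        by_cases hee : e = e₀
        · subst hee; simpa using add_nonneg (hy e) ha
        · simpa [hee] using hy e
      · intro e he
        simp only [Finset.mem_insert, not_or] at he
        simpa [he.1] using hyU e he.2
      · intro k
        by_cases hk : k = π e₀
        · subst hk; simpa using haz
        · simpa [hk] using hz k
      · intro k
        rw [sum_update_add]
        by_cases hk : k = π e₀
        · subst hk; simp; linarith [hs (π e₀)]
        · simp [hk, Ne.symm hk]; simpa using hs k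
  obtain ⟨y, z, hy, -, hz, hs, hc'⟩ := key Finset.univ
  have hz0 : ∀ k, z k = 0 := fun k => by
    have := hc' {k} ∅ (by simp)
    simp [h0] at this
    exact le_antisymm this (hz k)
  refine ⟨y, hy, fun F => by simpa using hc' ∅ F (by simp), fun k => by simpa [hz0] using hs k⟩

/-- The nonnegative vectors on `K` that stay below the demands `d`, vanish on `Z`, and satisfy
`u(T) ≤ h F` for all pairs `(T, F)` with `C T F`. -/
def region (C : Finset K → Finset α → Prop) (h : Finset α → ℝ) (d : K → ℝ≥0∞) (Z : Finset K) :
    Set (K → ℝ) :=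
  {u | (∀ k, 0 ≤ u k) ∧ (∀ k, ENNReal.ofReal (u k) ≤ d k) ∧ (∀ k ∈ Z, u k = 0) ∧
    ∀ T F, C T F → ∑ k ∈ T, u k ≤ h F}

/-- The region is compact, so the total on `S` has a maximum. -/
theorem exists_max_region [Fintype α] [Fintype K] (C : Finset K → Finset α → Prop)
    (h : Finset α → ℝ) (d : K → ℝ≥0∞) (Z : Finset K) (hne : ∀ T F, C T F → 0 ≤ h F)
    (hC : C Finset.univ Finset.univ) (S : Finset K) :
    ∃ u ∈ region C h d Z, ∀ u' ∈ region C h d Z, ∑ k ∈ S, u' k ≤ ∑ k ∈ S, u k := by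
  have hcl : IsClosed (region C h d Z) := by
    unfold region
    simp only [Set.ofPred_and, Set.ofPred_forall]
    refine IsClosed.inter (isClosed_iInter fun k => isClosed_le (by fun_prop) (by fun_prop)) ?_
    refine IsClosed.inter (isClosed_iInter fun k => isClosed_le
      (ENNReal.continuous_ofReal.comp (continuous_apply k)) (by fun_prop)) ?_
    refine IsClosed.inter (isClosed_iInter fun k => isClosed_iInter fun _ =>
      isClosed_eq (by fun_prop) (by fun_prop)) ?_
    exact isClosed_iInter fun T => isClosed_iInter fun F => isClosed_iInter fun _ =>
      isClosed_le (by fun_prop) (by fun_prop)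
  have hcomp : IsCompact (region C h d Z) := by
    refine (isCompact_Icc (a := (0 : K → ℝ)) (b := fun _ => h Finset.univ)).of_isClosed_subset
      hcl ?_
    rintro u ⟨h0, -, -, h1⟩
    refine ⟨h0, fun k => ?_⟩
    exact (Finset.single_le_sum (fun j _ => h0 j) (Finset.mem_univ k)).trans (h1 _ _ hC)
  obtain ⟨u, hu, hmax⟩ := hcomp.exists_isMaxOn (f := fun u => ∑ k ∈ S, u k)
    ⟨0, by simp, by simp, by simp, by simpa using hne⟩ (by fun_prop)
  exact ⟨u, hu, fun u' hu' => hmax hu'⟩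

theorem exists_pos_ofReal_add_le {a : ℝ} (ha : 0 ≤ a) {d : ℝ≥0∞} (h : ENNReal.ofReal a < d) :
    ∃ κ > 0, ENNReal.ofReal (a + κ) ≤ d := by
  by_cases hd : d = ⊤
  · exact ⟨1, one_pos, by simp [hd]⟩
  · refine ⟨d.toReal - a, ?_, ?_⟩
    · exact sub_pos.2 ((ENNReal.ofReal_lt_iff_lt_toReal ha hd).1 h)
    · simp [hd]

/-- A vector of maximal total in a region bounded by a submodular function on a lattice of pairs
is saturated outside a single tight pair. -/
theorem exists_tight_of_max [DecidableEq α] [DecidableEq K] [Fintype α] [Fintype K]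
    {C : Finset K → Finset α → Prop} {h : Finset α → ℝ} {d : K → ℝ≥0∞} {Z : Finset K}
    (hsub : ∀ F F', h (F ∪ F') + h (F ∩ F') ≤ h F + h F') (h0 : h ∅ = 0)
    (hC0 : C ∅ ∅) (hCu : ∀ T F T' F', C T F → C T' F' → C (T ∪ T') (F ∪ F'))
    (hCi : ∀ T F T' F', C T F → C T' F' → C (T ∩ T') (F ∩ F'))
    {u : K → ℝ} (hu : u ∈ region C h d Z)
    (hmax : ∀ u' ∈ region C h d Z, ∑ k, u' k ≤ ∑ k, u k) :
    ∃ T F, C T F ∧ ∑ k ∈ T, u k = h F ∧ ∀ k, k ∉ T → k ∉ Z → ENNReal.ofReal (u k) = d k := by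
  classical
  obtain ⟨hu0, hud, huZ, huC⟩ := hu
  have step : ∀ k, k ∉ Z → ENNReal.ofReal (u k) ≠ d k →
      ∃ T F, C T F ∧ k ∈ T ∧ ∑ k ∈ T, u k = h F := by
    intro k hkZ hkd
    by_contra! hno
    obtain ⟨κ₁, hκ₁, hκd⟩ := exists_pos_ofReal_add_le (hu0 k) (lt_of_le_of_ne (hud k) hkd)
    obtain ⟨κ₂, hκ₂, hκC⟩ := exists_pos_le_of_finite
      (fun p : {p : Finset K × Finset α // C p.1 p.2 ∧ k ∈ p.1} => h p.1.2 - ∑ k ∈ p.1.1, u k)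
      (fun p => sub_pos.2 (lt_of_le_of_ne (huC _ _ p.2.1) (hno _ _ p.2.1 p.2.2)))
    have hpos : 0 < min κ₁ κ₂ := lt_min hκ₁ hκ₂
    have := hmax (Function.update u k (u k + min κ₁ κ₂)) ⟨?_, ?_, ?_, ?_⟩
    · rw [sum_update_add] at this
      simp at this
      rcases this with h | h <;> linarith
    · intro j
      by_cases hj : j = k
      · subst hj; simpa using add_nonneg (hu0 j) hpos.le
      · simpa [hj] using hu0 j
    · intro j
      by_cases hj : j = k
      · subst hj
        simp only [Function.update_self]
        exact (ENNReal.ofReal_le_ofReal (by linarith [min_le_left κ₁ κ₂])).trans hκd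
      · simpa [hj] using hud j
    · intro j hj
      have : j ≠ k := by rintro rfl; exact hkZ hj
      simpa [this] using huZ j hj
    · intro T F hTF
      rw [sum_update_add]
      split_ifs with hkT
      · have := hκC ⟨(T, F), hTF, hkT⟩
        dsimp only at this
        linarith [min_le_right κ₁ κ₂]
      · simpa using huC T F hTF
  have key : ∀ S : Finset K, ∃ T F, C T F ∧ ∑ k ∈ T, u k = h F ∧
      ∀ k ∈ S, k ∉ T → k ∉ Z → ENNReal.ofReal (u k) = d k := by
    intro S
    induction S using Finset.induction_on with
    | empty => exact ⟨∅, ∅, hC0, by simp [h0], by simp⟩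
    | insert k S _ ih =>
      obtain ⟨T, F, hTF, ht, hS⟩ := ih
      by_cases hk : k ∉ Z ∧ ENNReal.ofReal (u k) ≠ d k
      · obtain ⟨T', F', hTF', hkT', ht'⟩ := step k hk.1 hk.2
        refine ⟨T ∪ T', F ∪ F', hCu _ _ _ _ hTF hTF', ?_, ?_⟩
        · have h1 := huC _ _ (hCu _ _ _ _ hTF hTF')
          have h2 := huC _ _ (hCi _ _ _ _ hTF hTF')
          have h3 := hsub F F'
          have h4 := Finset.sum_union_inter (f := u) (s₁ := T) (s₂ := T')
          linarith
        · intro j hj hjT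
          simp only [Finset.mem_union, not_or] at hjT
          rcases Finset.mem_insert.1 hj with rfl | hj
          · exact absurd hkT' hjT.2
          · exact hS j hj hjT.1
      · refine ⟨T, F, hTF, ht, ?_⟩
        intro j hj hjT hjZ
        rcases Finset.mem_insert.1 hj with rfl | hj
        · by_contra hne
          exact hk ⟨hjZ, hne⟩
        · exact hS j hj hjT hjZ
  obtain ⟨T, F, hTF, ht, hS⟩ := key Finset.univ
  exact ⟨T, F, hTF, ht, fun k => hS k (Finset.mem_univ k)⟩

/-- A vector `x` below a submodular function `φ` such that each coordinate in `H` is saturated or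
lies in a tight subset of `H` has the largest total on `H` among the vectors below `φ` and the
caps. -/
theorem sum_le_sum_of_tight [DecidableEq K] {φ : Finset K → ℝ}
    (hsub : ∀ S T, φ (S ∪ T) + φ (S ∩ T) ≤ φ S + φ T) (h0 : φ ∅ = 0) {x z : K → ℝ} {H : Finset K}
    (hx : ∀ T, ∑ k ∈ T, x k ≤ φ T) (hz : ∀ T, ∑ k ∈ T, z k ≤ φ T)
    (hH : ∀ k ∈ H, z k ≤ x k ∨ ∃ T ⊆ H, k ∈ T ∧ φ T ≤ ∑ k ∈ T, x k) :
    ∑ k ∈ H, z k ≤ ∑ k ∈ H, x k := by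
  have key : ∀ S ⊆ H, ∃ T ⊆ H, φ T ≤ ∑ k ∈ T, x k ∧ ∀ k ∈ S, k ∉ T → z k ≤ x k := by
    intro S
    induction S using Finset.induction_on with
    | empty => exact fun _ => ⟨∅, by simp, by simp [h0], by simp⟩
    | insert k S _ ih =>
      intro hS
      obtain ⟨T, hT, ht, hc⟩ := ih ((Finset.subset_insert _ _).trans hS)
      rcases hH k (hS (Finset.mem_insert_self _ _)) with hk | ⟨T', hT', hkT', ht'⟩
      · refine ⟨T, hT, ht, fun j hj hjT => ?_⟩
        rcases Finset.mem_insert.1 hj with rfl | hj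
        exacts [hk, hc j hj hjT]
      · refine ⟨T ∪ T', Finset.union_subset hT hT', ?_, fun j hj hjT => ?_⟩
        · have := hsub T T'
          have := hx (T ∩ T')
          have := Finset.sum_union_inter (f := x) (s₁ := T) (s₂ := T')
          linarith
        · simp only [Finset.mem_union, not_or] at hjT
          rcases Finset.mem_insert.1 hj with rfl | hj
          exacts [absurd hkT' hjT.2, hc j hj hjT.1]
  obtain ⟨T, hT, ht, hc⟩ := key H subset_rfl
  rw [← Finset.sum_sdiff hT, ← Finset.sum_sdiff hT]
  refine add_le_add (Finset.sum_le_sum fun k hk => ?_) ((hz T).trans ht)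
  rw [Finset.mem_sdiff] at hk
  exact hc k hk.1 hk.2

/-- Comparing the totals on all upper level sets of `v` suffices for comparing the weighted sums. -/
theorem sum_mul_le_sum_mul_of_upper [Fintype K] {v : K → ℝ} {ε : ℝ} (hε : 0 < ε)
    (hv : ∀ k, ∃ a : ℕ, v k = a * ε) {x z : K → ℝ}
    (h : ∀ t : ℝ, ∑ k with t ≤ v k, z k ≤ ∑ k with t ≤ v k, x k) :
    ∑ k, v k * z k ≤ ∑ k, v k * x k := by
  choose a ha using hv
  obtain ⟨M, hM⟩ : ∃ M, ∀ k, a k ≤ M := ⟨∑ k, a k, fun k =>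
    Finset.single_le_sum (fun _ _ => Nat.zero_le _) (Finset.mem_univ k)⟩
  -- each valuation is cut into layers of height `ε`
  have layer : ∀ y : K → ℝ, ∑ k, v k * y k =
      ∑ t ∈ Finset.range M, ε * ∑ k with ((t + 1 : ℕ) : ℝ) * ε ≤ v k, y k := by
    intro y
    simp_rw [Finset.sum_filter, Finset.mul_sum]
    rw [Finset.sum_comm]
    refine Finset.sum_congr rfl fun k _ => ?_
    have : ∀ t : ℕ, (((t + 1 : ℕ) : ℝ) * ε ≤ v k) ↔ t < a k := fun t => by
      rw [ha, mul_le_mul_iff_left₀ hε, Nat.cast_le, Nat.succ_le_iff]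
    simp_rw [this, mul_ite, mul_zero]
    rw [← Finset.sum_filter, Finset.sum_const, nsmul_eq_mul, ha]
    have : (Finset.range M).filter (fun t => t < a k) = Finset.range (a k) := by
      ext t; simp; intro h; exact h.trans_le (hM k)
    rw [this, Finset.card_range]; ring
  rw [layer, layer]
  exact Finset.sum_le_sum fun t _ => mul_le_mul_of_nonneg_left (h _) hε.le

end Submodular

/-! ### The remnant supply at the level of the buyers -/

namespace Market

variable {N m : ℕ} {G : Market N m}

theorem totalF_empty (hG : G.IsPolymatroidal) : G.totalF ∅ = 0 := by
  simp [totalF, hG.empty]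

theorem totalF_mono (hG : G.IsPolymatroidal) {F F' : Finset (Fin N × Fin m)} (h : F ⊆ F') :
    G.totalF F ≤ G.totalF F' :=
  Finset.sum_le_sum fun j _ => hG.mono j _ _ (Finset.inter_subset_inter_right h)
    Finset.inter_subset_right

theorem totalF_submodular (hG : G.IsPolymatroidal) (F F' : Finset (Fin N × Fin m)) :
    G.totalF (F ∪ F') + G.totalF (F ∩ F') ≤ G.totalF F + G.totalF F' := by
  unfold totalF
  rw [← Finset.sum_add_distrib, ← Finset.sum_add_distrib]
  refine Finset.sum_le_sum fun j _ => ?_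
  rw [Finset.union_inter_distrib_right, Finset.inter_inter_distrib_right]
  exact hG.submodular j _ _ Finset.inter_subset_right Finset.inter_subset_right

theorem inter_inter_sellerEdges (F : Finset (Fin N × Fin m)) (j : Fin m) :
    F ∩ G.E ∩ G.sellerEdges j = F ∩ G.sellerEdges j := by
  ext e; simp only [sellerEdges, Finset.mem_inter, Finset.mem_filter]; tauto

theorem totalF_inter_edges (F : Finset (Fin N × Fin m)) : G.totalF (F ∩ G.E) = G.totalF F := by
  simp only [totalF, inter_inter_sellerEdges]

theorem totalF_of_subset_sellerEdges (hG : G.IsPolymatroidal) {F : Finset (Fin N × Fin m)}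
    {j : Fin m} (h : F ⊆ G.sellerEdges j) : G.totalF F = G.f j F := by
  unfold totalF
  rw [Finset.sum_eq_single j]
  · rw [Finset.inter_eq_left.2 h]
  · intro j' _ hj
    have : F ∩ G.sellerEdges j' = ∅ := by
      ext e
      simp only [Finset.mem_inter, Finset.notMem_empty, iff_false, not_and]
      intro he he'
      have h1 := h he
      simp only [sellerEdges, Finset.mem_filter] at h1 he'
      exact hj (he'.2 ▸ h1.2)
    rw [this, hG.empty]
  · simp

theorem sum_eq_sum_sellerEdges {w : Fin N × Fin m → ℝ} (hw : ∀ e, e ∉ G.E → w e = 0)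
    (F : Finset (Fin N × Fin m)) :
    ∑ e ∈ F, w e = ∑ j, ∑ e ∈ F ∩ G.sellerEdges j, w e := by
  have h1 : ∑ e ∈ F, w e = ∑ e ∈ F ∩ G.E, w e := by
    symm
    refine Finset.sum_subset Finset.inter_subset_left fun e he he' => hw e fun h => he' ?_
    exact Finset.mem_inter.2 ⟨he, h⟩
  rw [h1, ← Finset.sum_fiberwise (F ∩ G.E) Prod.snd]
  refine Finset.sum_congr rfl fun j _ => Finset.sum_congr ?_ fun _ _ => rfl
  ext e; simp only [sellerEdges, Finset.mem_inter, Finset.mem_filter]; tauto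

theorem mem_polytope_iff (hG : G.IsPolymatroidal) {w : Fin N × Fin m → ℝ} :
    w ∈ G.polytope ↔
      (∀ e, 0 ≤ w e) ∧ (∀ e, e ∉ G.E → w e = 0) ∧ ∀ F, ∑ e ∈ F, w e ≤ G.totalF F := by
  constructor
  · rintro ⟨h0, hE, h⟩
    refine ⟨h0, hE, fun F => ?_⟩
    rw [sum_eq_sum_sellerEdges hE]
    exact Finset.sum_le_sum fun j _ => h j _ Finset.inter_subset_right
  · rintro ⟨h0, hE, h⟩
    exact ⟨h0, hE, fun j F hF => (h F).trans_eq (totalF_of_subset_sellerEdges hG hF)⟩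

/-- The supply `f(F) - w(F)` that remains for a set `F` of edges when `w` has been sold. -/
def residual (G : Market N m) (w : Fin N × Fin m → ℝ) (F : Finset (Fin N × Fin m)) : ℝ :=
  G.totalF F - ∑ e ∈ F, w e

theorem residual_submodular (hG : G.IsPolymatroidal) (w : Fin N × Fin m → ℝ)
    (F F' : Finset (Fin N × Fin m)) :
    G.residual w (F ∪ F') + G.residual w (F ∩ F') ≤ G.residual w F + G.residual w F' := by
  have h1 := totalF_submodular hG F F'
  have h2 := Finset.sum_union_inter (f := w) (s₁ := F) (s₂ := F')
  unfold residual; linarith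

theorem residual_empty (hG : G.IsPolymatroidal) (w : Fin N × Fin m → ℝ) :
    G.residual w ∅ = 0 := by simp [residual, totalF_empty hG]

theorem residual_nonneg (hG : G.IsPolymatroidal) {w : Fin N × Fin m → ℝ} (hw : w ∈ G.polytope)
    (F : Finset (Fin N × Fin m)) : 0 ≤ G.residual w F :=
  sub_nonneg.2 (((mem_polytope_iff hG).1 hw).2.2 F)

theorem residual_congr {w : Fin N × Fin m → ℝ} (hw : ∀ e, e ∉ G.E → w e = 0)
    {F F' : Finset (Fin N × Fin m)} (h : F ∩ G.E = F' ∩ G.E) :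
    G.residual w F = G.residual w F' := by
  have : ∀ A : Finset (Fin N × Fin m), ∑ e ∈ A, w e = ∑ e ∈ A ∩ G.E, w e := fun A => by
    symm
    refine Finset.sum_subset Finset.inter_subset_left fun e he he' => hw e fun h => he' ?_
    exact Finset.mem_inter.2 ⟨he, h⟩
  unfold residual
  rw [this F, this F', ← totalF_inter_edges F, ← totalF_inter_edges F', h]

theorem residual_add (w η : Fin N × Fin m → ℝ) (F : Finset (Fin N × Fin m)) :
    G.residual (w + η) F = G.residual w F - ∑ e ∈ F, η e := by
  simp only [residual, Pi.add_apply, Finset.sum_add_distrib]; ring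

/-- All pairs with a first component in `T`. -/
def fiber (m : ℕ) (T : Finset (Fin N)) : Finset (Fin N × Fin m) :=
  Finset.univ.filter (fun e => e.1 ∈ T)

@[simp] theorem mem_fiber {T : Finset (Fin N)} {e : Fin N × Fin m} :
    e ∈ fiber m T ↔ e.1 ∈ T := by simp [fiber]

/-- `F` contains all edges of the buyers in `T`. -/
def Covers (T : Finset (Fin N)) (F : Finset (Fin N × Fin m)) : Prop := ∀ e, e.1 ∈ T → e ∈ F

/-- `F` is the set of all pairs with buyer in `T`. -/
def IsFiber (T : Finset (Fin N)) (F : Finset (Fin N × Fin m)) : Prop := F = fiber m T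

theorem totalF_edgesOf (T : Finset (Fin N)) : G.totalF (G.edgesOf T) = G.totalF (fiber m T) := by
  rw [← totalF_inter_edges (fiber m T)]
  congr 1
  ext e; simp [edgesOf, and_comm]

theorem amount_eq {w : Fin N × Fin m → ℝ} (hw : ∀ e, e ∉ G.E → w e = 0) (k : Fin N) :
    G.amount w k = ∑ e with e.1 = k, w e := by
  unfold amount buyerEdges
  refine Finset.sum_subset (Finset.filter_subset_filter _ (Finset.subset_univ _)) ?_
  intro e he he'
  simp only [Finset.mem_filter, Finset.mem_univ, true_and] at he he'
  exact hw e fun h => he' ⟨h, he⟩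

theorem sum_amount_eq {w : Fin N × Fin m → ℝ} (hw : ∀ e, e ∉ G.E → w e = 0)
    (T : Finset (Fin N)) : ∑ k ∈ T, G.amount w k = ∑ e ∈ fiber m T, w e := by
  simp_rw [amount_eq hw]
  rw [← Finset.sum_fiberwise_of_maps_to (t := T) (g := Prod.fst) (fun e he => mem_fiber.1 he)]
  refine Finset.sum_congr rfl fun k hk => Finset.sum_congr ?_ fun _ _ => rfl
  ext e; simp; rintro rfl; exact hk

theorem sum_amount_add_sum_le {w y : Fin N × Fin m → ℝ} (hw : ∀ e, e ∉ G.E → y e = 0)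
    {T : Finset (Fin N)} {F : Finset (Fin N × Fin m)} (hTF : Covers T F)
    (hwy : ∀ e, w e ≤ y e) (hwT : ∀ e, e.1 ∈ T → w e ≤ 0) :
    ∑ k ∈ T, G.amount y k + ∑ e ∈ F, w e ≤ ∑ e ∈ F, y e := by
  have h1 : fiber m T ⊆ F := fun e he => hTF e (mem_fiber.1 he)
  rw [sum_amount_eq hw, ← Finset.sum_sdiff h1, ← Finset.sum_sdiff h1]
  have h2 : ∑ e ∈ fiber m T, w e ≤ 0 := Finset.sum_nonpos fun e he => hwT e (mem_fiber.1 he)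
  have h3 : ∑ e ∈ F \ fiber m T, w e ≤ ∑ e ∈ F \ fiber m T, y e :=
    Finset.sum_le_sum fun e _ => hwy e
  linarith

/-- The amounts that the buyers can still obtain, the buyers in `Z` obtaining nothing. For a
feasible `w` and empty `Z` these are the vectors of amounts of the elements of `P_{w,d}`. -/
def futures (G : Market N m) (w : Fin N × Fin m → ℝ) (d : Fin N → ℝ≥0∞) (Z : Finset (Fin N)) :
    Set (Fin N → ℝ) :=
  region Covers (G.residual w) d Z

/-- The transactions `ξ` of buyer `i` as a vector on all pairs. -/
def lift (i : Fin N) (ξ : Fin m → ℝ) (e : Fin N × Fin m) : ℝ := if e.1 = i then ξ e.2 else 0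

theorem lift_nonneg {i : Fin N} {ξ : Fin m → ℝ} (h : ∀ j, 0 ≤ ξ j) (e : Fin N × Fin m) :
    0 ≤ lift i ξ e := by unfold lift; split_ifs; exacts [h _, le_rfl]

theorem lift_off {i : Fin N} {ξ : Fin m → ℝ} (h : ∀ j, (i, j) ∉ G.E → ξ j = 0)
    (e : Fin N × Fin m) (he : e ∉ G.E) : lift i ξ e = 0 := by
  obtain ⟨a, b⟩ := e
  unfold lift; split_ifs with h1
  · simp only at h1; subst h1; exact h _ he
  · rfl

theorem sum_lift_of_forall_mem {i : Fin N} (ξ : Fin m → ℝ) {F : Finset (Fin N × Fin m)}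
    (h : ∀ e : Fin N × Fin m, e.1 = i → e ∈ F) : ∑ e ∈ F, lift i ξ e = ∑ j, ξ j := by
  rw [Finset.sum_subset (Finset.subset_univ F)]
  · simp [lift, Fintype.sum_prod_type]
  · intro e _ he
    unfold lift; rw [if_neg]; exact fun h' => he (h e h')

theorem sum_lift_fiber_of_notMem {i : Fin N} (ξ : Fin m → ℝ) {T : Finset (Fin N)} (h : i ∉ T) :
    ∑ e ∈ fiber m T, lift i ξ e = 0 := by
  refine Finset.sum_eq_zero fun e he => ?_
  unfold lift; rw [if_neg]; rintro rfl; exact h (mem_fiber.1 he)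

theorem amount_lift {i : Fin N} {ξ : Fin m → ℝ} (h : ∀ j, (i, j) ∉ G.E → ξ j = 0) (k : Fin N) :
    G.amount (lift i ξ) k = if k = i then ∑ j, ξ j else 0 := by
  rw [amount_eq (lift_off h)]
  split_ifs with hk
  · exact sum_lift_of_forall_mem ξ (by simp [hk])
  · refine Finset.sum_eq_zero fun e he => ?_
    simp only [Finset.mem_filter, Finset.mem_univ, true_and] at he
    unfold lift; rw [if_neg]; rintro rfl; exact hk he.symm

theorem amount_add (w y : Fin N × Fin m → ℝ) (k : Fin N) :
    G.amount (w + y) k = G.amount w k + G.amount y k := by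
  simp [amount, Finset.sum_add_distrib]

/-- The possible futures of the other buyers, if buyer `i` transacts `ξ`. -/
theorem mem_othersFuture_iff (hG : G.IsPolymatroidal) {w : Fin N × Fin m → ℝ}
    (hw : w ∈ G.polytope) (d : Fin N → ℝ≥0∞) (i : Fin N) {ξ : Fin m → ℝ} (hξ : ∀ j, 0 ≤ ξ j)
    (hξE : ∀ j, (i, j) ∉ G.E → ξ j = 0) {u : Fin N → ℝ} (hui : u i = 0) :
    (fun k : {k // k ≠ i} => u k) ∈ G.othersFuture w d i ξ ↔
      (∀ k, 0 ≤ u k) ∧ (∀ k, ENNReal.ofReal (u k) ≤ d k) ∧ ENNReal.ofReal (∑ j, ξ j) ≤ d i ∧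
      ∀ T F, i ∉ T → Covers T F → ∑ k ∈ T, u k + ∑ e ∈ F, lift i ξ e ≤ G.residual w F := by
  constructor
  · rintro ⟨h0, y, ⟨hy0, hyE, hwy, hyd⟩, hyξ, hyu⟩
    have hy' : ∀ e : Fin N × Fin m, e.1 = i → y e = ξ e.2 := fun e he => by
      by_cases heE : e ∈ G.E
      · exact hyξ e (by simp [buyerEdges, heE, he])
      · rw [hyE e heE]
        obtain ⟨a, b⟩ := e
        simp only at he; subst he
        exact (hξE _ heE).symm
    have hlift : ∀ e, lift i ξ e ≤ y e := fun e => by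
      unfold lift; split_ifs with h
      exacts [(hy' e h).ge, hy0 e]
    have hu : ∀ k, k ≠ i → G.amount y k = u k := fun k hk => hyu ⟨k, hk⟩
    refine ⟨fun k => ?_, fun k => ?_, ?_, fun T F hiT hTF => ?_⟩
    · by_cases hk : k = i
      · rw [hk, hui]
      · exact h0 ⟨k, hk⟩
    · by_cases hk : k = i
      · rw [hk, hui]; simp
      · rw [← hu k hk]; exact hyd k
    · convert hyd i using 2
      rw [amount_eq hyE,
        ← sum_lift_of_forall_mem (i := i) (F := Finset.univ.filter (fun e => e.1 = i)) ξ
        (by simp)]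
      refine Finset.sum_congr rfl fun e he => ?_
      simp only [Finset.mem_filter, Finset.mem_univ, true_and] at he
      rw [hy' e he]; simp [lift, he]
    · have h1 := sum_amount_add_sum_le (w := lift i ξ) hyE hTF hlift (fun e he => by
        unfold lift; rw [if_neg]; rintro rfl; exact hiT he)
      have h2 : ∑ k ∈ T, G.amount y k = ∑ k ∈ T, u k :=
        Finset.sum_congr rfl fun k hk => hu k (by rintro rfl; exact hiT hk)
      have h3 := ((mem_polytope_iff hG).1 hwy).2.2 F
      simp only [Pi.add_apply, Finset.sum_add_distrib] at h3
      unfold residual; linarith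
  · rintro ⟨h0, hd, hξd, hC⟩
    refine ⟨fun k => h0 k, ?_⟩
    obtain ⟨y, hy0, hyF, hyu⟩ := exists_split Prod.fst (G.residual (w + lift i ξ))
      (residual_submodular hG _) (residual_empty hG _) u h0 (fun T F hTF => by
        rw [residual_add]
        have h1 := hC (T.erase i) F (by simp) (fun e he => hTF e (Finset.mem_of_mem_erase he))
        rw [Finset.sum_erase _ hui] at h1
        linarith)
    obtain ⟨hw0, hwE, hwF⟩ := (mem_polytope_iff hG).1 hw
    have hyE : ∀ e, e ∉ G.E → y e = 0 := fun e he => by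
      have h1 := hyF {e}
      have h2 : ({e} : Finset (Fin N × Fin m)) ∩ G.E = ∅ := by simp [he]
      rw [residual, ← totalF_inter_edges, h2, totalF_empty hG] at h1
      simp [hwE e he, lift_off hξE e he] at h1
      exact le_antisymm h1 (hy0 e)
    have hyi : ∀ e : Fin N × Fin m, e.1 = i → y e = 0 := fun e he => by
      have h1 := hyu i
      rw [hui, Finset.sum_eq_zero_iff_of_nonneg (fun e _ => hy0 e)] at h1
      exact h1 e (by simp [he])
    have hoff : ∀ e, e ∉ G.E → (lift i ξ + y) e = 0 := fun e he => by
      simp [hyE e he, lift_off hξE e he]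
    have hamt : ∀ k, G.amount (lift i ξ + y) k = (if k = i then ∑ j, ξ j else 0) + u k := by
      intro k
      rw [amount_add, amount_lift hξE, amount_eq hyE, hyu]
    refine ⟨lift i ξ + y, ⟨fun e => add_nonneg (lift_nonneg hξ e) (hy0 e), hoff, ?_, ?_⟩, ?_, ?_⟩
    · rw [mem_polytope_iff hG]
      refine ⟨fun e => add_nonneg (hw0 e) (add_nonneg (lift_nonneg hξ e) (hy0 e)), fun e he => ?_,
        fun F => ?_⟩
      · rw [Pi.add_apply, hoff e he, hwE e he, add_zero]
      · have h1 := hyF F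
        simp only [residual, Pi.add_apply, Finset.sum_add_distrib] at h1 ⊢
        linarith
    · intro k
      rw [hamt]
      split_ifs with hk
      · rw [hk, hui, add_zero]; exact hξd
      · rw [zero_add]; exact hd k
    · intro e he
      have : e.1 = i := by simp [buyerEdges] at he; exact he.2
      simp [lift, this, hyi e this]
    · intro k
      rw [hamt, if_neg k.2, zero_add]

theorem mem_futures_singleton_iff {w : Fin N × Fin m → ℝ} {d : Fin N → ℝ≥0∞} {i : Fin N}
    {u : Fin N → ℝ} : u ∈ G.futures w d {i} ↔ u i = 0 ∧
      (∀ k, 0 ≤ u k) ∧ (∀ k, ENNReal.ofReal (u k) ≤ d k) ∧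
      ∀ T F, i ∉ T → Covers T F → ∑ k ∈ T, u k ≤ G.residual w F := by
  constructor
  · rintro ⟨h0, hd, hi, hC⟩
    exact ⟨hi i (by simp), h0, hd, fun T F _ => hC T F⟩
  · rintro ⟨hi, h0, hd, hC⟩
    refine ⟨h0, hd, by simpa using hi, fun T F hTF => ?_⟩
    rw [← Finset.sum_erase T hi]
    exact hC _ F (by simp) fun e he => hTF e (Finset.mem_of_mem_erase he)

theorem mem_clinchingPolytope_iff (hG : G.IsPolymatroidal) {w : Fin N × Fin m → ℝ}
    (hw : w ∈ G.polytope) {d : Fin N → ℝ≥0∞} {i : Fin N} {ξ : Fin m → ℝ} :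
    ξ ∈ G.clinchingPolytope w d i ↔ (∀ j, 0 ≤ ξ j) ∧ (∀ j, (i, j) ∉ G.E → ξ j = 0) ∧
      ∀ u ∈ G.futures w d {i}, ENNReal.ofReal (∑ j, ξ j) ≤ d i ∧
        ∀ T F, i ∉ T → Covers T F → ∑ k ∈ T, u k + ∑ e ∈ F, lift i ξ e ≤ G.residual w F := by
  have zero_iff : ∀ u : Fin N → ℝ, u i = 0 →
      ((fun k : {k // k ≠ i} => u k) ∈ G.othersFuture w d i 0 ↔ u ∈ G.futures w d {i}) := by
    intro u hui
    rw [mem_othersFuture_iff hG hw d i (by simp) (by simp) hui, mem_futures_singleton_iff]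
    simp [hui, lift]
  constructor
  · rintro ⟨h0, hE, heq⟩
    refine ⟨h0, hE, fun u hu => ?_⟩
    have hui : u i = 0 := hu.2.2.1 i (by simp)
    have h1 := (zero_iff u hui).2 hu
    rw [← heq, mem_othersFuture_iff hG hw d i h0 hE hui] at h1
    exact h1.2.2
  · rintro ⟨h0, hE, h⟩
    refine ⟨h0, hE, ?_⟩
    ext v
    obtain ⟨u, hui, rfl⟩ : ∃ u : Fin N → ℝ, u i = 0 ∧ v = fun k : {k // k ≠ i} => u k :=
      ⟨fun k => if hk : k ≠ i then v ⟨k, hk⟩ else 0, by simp, by ext k; simp [k.2]⟩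
    rw [zero_iff u hui, mem_othersFuture_iff hG hw d i h0 hE hui]
    constructor
    · rintro ⟨hu0, hud, hξd, hC⟩
      refine mem_futures_singleton_iff.2 ⟨hui, hu0, hud, fun T F hi hTF => ?_⟩
      have h1 := hC T F hi hTF
      have h2 : 0 ≤ ∑ e ∈ F, lift i ξ e := Finset.sum_nonneg fun e _ => lift_nonneg h0 e
      linarith
    · intro hu
      exact ⟨hu.1, hu.2.1, h u hu⟩

theorem zero_mem_futures (hG : G.IsPolymatroidal) {w : Fin N × Fin m → ℝ}
    (hw : w ∈ G.polytope) (d : Fin N → ℝ≥0∞) (Z : Finset (Fin N)) : 0 ∈ G.futures w d Z :=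
  ⟨by simp, by simp, by simp, fun T F _ => by simpa using residual_nonneg hG hw F⟩

theorem exists_maximal_clinch (hG : G.IsPolymatroidal) {w : Fin N × Fin m → ℝ}
    (hw : w ∈ G.polytope) (d : Fin N → ℝ≥0∞) (i : Fin N) :
    ∃ ξ, Maximal (· ∈ G.clinchingPolytope w d i) ξ := by
  have hcl : IsClosed (G.clinchingPolytope w d i) := by
    have : G.clinchingPolytope w d i = {ξ | (∀ j, 0 ≤ ξ j) ∧ (∀ j, (i, j) ∉ G.E → ξ j = 0) ∧
      ∀ u ∈ G.futures w d {i}, ENNReal.ofReal (∑ j, ξ j) ≤ d i ∧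
        ∀ T F, i ∉ T → Covers T F → ∑ k ∈ T, u k + ∑ e ∈ F, lift i ξ e ≤ G.residual w F} := by
      ext ξ; exact mem_clinchingPolytope_iff hG hw
    rw [this]
    simp only [Set.ofPred_and, Set.ofPred_forall]
    have hl : ∀ e : Fin N × Fin m, Continuous fun ξ : Fin m → ℝ => lift i ξ e := fun e => by
      unfold lift; split_ifs <;> fun_prop
    refine IsClosed.inter (isClosed_iInter fun k => isClosed_le (by fun_prop) (by fun_prop)) ?_
    refine IsClosed.inter (isClosed_iInter fun k => isClosed_iInter fun _ =>
      isClosed_eq (by fun_prop) (by fun_prop)) ?_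
    refine isClosed_iInter fun u => isClosed_iInter fun _ => IsClosed.inter
      (isClosed_le (ENNReal.continuous_ofReal.comp (by fun_prop)) (by fun_prop)) ?_
    exact isClosed_iInter fun T => isClosed_iInter fun F => isClosed_iInter fun _ =>
      isClosed_iInter fun _ => isClosed_le (by fun_prop) (by fun_prop)
  have hcomp : IsCompact (G.clinchingPolytope w d i) := by
    refine (isCompact_Icc (a := (0 : Fin m → ℝ))
      (b := fun _ => G.residual w Finset.univ)).of_isClosed_subset hcl ?_
    intro ξ hξ
    obtain ⟨h0, -, h⟩ := (mem_clinchingPolytope_iff hG hw).1 hξ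
    refine ⟨h0, fun j => ?_⟩
    have h1 := (h 0 (zero_mem_futures hG hw d _)).2 ∅ Finset.univ (by simp) (by simp [Covers])
    rw [sum_lift_of_forall_mem ξ (by simp)] at h1
    have h2 := Finset.single_le_sum (fun j _ => h0 j) (Finset.mem_univ j)
    simp at h1
    exact h2.trans h1
  obtain ⟨ξ, hξ, hmax⟩ := hcomp.exists_isMaxOn (f := fun ξ => ∑ j, ξ j)
    ⟨0, by simp, by simp, rfl⟩ (by fun_prop)
  refine ⟨ξ, hξ, fun ζ hζ hle => ?_⟩
  have h1 : ∑ j, ζ j ≤ ∑ j, ξ j := hmax hζ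
  have h2 := (Finset.sum_eq_sum_iff_of_le (fun j _ => hle j)).1
    (le_antisymm (Finset.sum_le_sum fun j _ => hle j) h1)
  exact fun j => (h2 j (Finset.mem_univ j)).ge

/-! ### The effect of clinching -/

/-- The demands after buyer `i` has bought the amount `δ`. -/
def lower (d : Fin N → ℝ≥0∞) (i : Fin N) (δ : ℝ) : Fin N → ℝ≥0∞ :=
  Function.update d i (d i - ENNReal.ofReal δ)

theorem sum_nonneg_of_clinch {w : Fin N × Fin m → ℝ} {d : Fin N → ℝ≥0∞} {i : Fin N}
    {ξ : Fin m → ℝ} (hξ : ξ ∈ G.clinchingPolytope w d i) : 0 ≤ ∑ j, ξ j :=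
  Finset.sum_nonneg fun j _ => hξ.1 j

theorem clinch_le_demand (hG : G.IsPolymatroidal) {w : Fin N × Fin m → ℝ}
    (hw : w ∈ G.polytope) {d : Fin N → ℝ≥0∞} {i : Fin N} {ξ : Fin m → ℝ}
    (hξ : ξ ∈ G.clinchingPolytope w d i) : ENNReal.ofReal (∑ j, ξ j) ≤ d i :=
  (((mem_clinchingPolytope_iff hG hw).1 hξ).2.2 0 (zero_mem_futures hG hw d _)).1

theorem polytope_of_clinch (hG : G.IsPolymatroidal) {w : Fin N × Fin m → ℝ}
    (hw : w ∈ G.polytope) {d : Fin N → ℝ≥0∞} {i : Fin N} {ξ : Fin m → ℝ}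
    (hξ : ξ ∈ G.clinchingPolytope w d i) : w + lift i ξ ∈ G.polytope := by
  obtain ⟨hw0, hwE, hwF⟩ := (mem_polytope_iff hG).1 hw
  refine (mem_polytope_iff hG).2 ⟨fun e => add_nonneg (hw0 e) (lift_nonneg hξ.1 e),
    fun e he => by simp [hwE e he, lift_off hξ.2.1 e he], fun F => ?_⟩
  have h := (((mem_clinchingPolytope_iff hG hw).1 hξ).2.2 0 (zero_mem_futures hG hw d _)).2
    ∅ F (by simp) (by simp [Covers])
  simp only [residual, Finset.sum_empty, zero_add] at h
  simp only [Pi.add_apply, Finset.sum_add_distrib]; linarith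

/-- After a clinch the futures are the old ones with the clinched amount taken off. -/
theorem sub_mem_futures (hG : G.IsPolymatroidal) {w : Fin N × Fin m → ℝ}
    (hw : w ∈ G.polytope) {d : Fin N → ℝ≥0∞} {i : Fin N} {ξ : Fin m → ℝ}
    (hξ : ξ ∈ G.clinchingPolytope w d i) {u : Fin N → ℝ} {Z : Finset (Fin N)}
    (hu : u ∈ G.futures w d Z) (hZ : i ∉ Z) (hi : ∑ j, ξ j ≤ u i) :
    Function.update u i (u i - ∑ j, ξ j) ∈ G.futures (w + lift i ξ) (lower d i (∑ j, ξ j)) Z := by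
  obtain ⟨h0, hd, hz, hC⟩ := hu
  have hδ := sum_nonneg_of_clinch hξ
  refine ⟨fun k => ?_, fun k => ?_, fun k hk => ?_, fun T F hTF => ?_⟩
  · by_cases hk : k = i
    · subst hk; simpa using hi
    · simpa [hk] using h0 k
  · by_cases hk : k = i
    · subst hk
      simp only [lower, Function.update_self]
      rw [ENNReal.ofReal_sub _ hδ]
      exact tsub_le_tsub_right (hd k) _
    · simpa [lower, hk] using hd k
  · have : k ≠ i := by rintro rfl; exact hZ hk
    simpa [this] using hz k hk
  · rw [residual_add, sum_update_sub]
    split_ifs with hiT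
    · rw [sum_lift_of_forall_mem ξ (fun e he => hTF e (he ▸ hiT))]
      linarith [hC T F hTF]
    · have hu' : Function.update u i 0 ∈ G.futures w d {i} := by
        rw [mem_futures_singleton_iff]
        refine ⟨by simp, fun k => ?_, fun k => ?_, fun T F hiT hTF => ?_⟩
        · by_cases hk : k = i
          · subst hk; simp
          · simpa [hk] using h0 k
        · by_cases hk : k = i
          · subst hk; simp
          · simpa [hk] using hd k
        · rw [Finset.sum_update_of_notMem hiT]; exact hC T F hTF
      have h1 := (((mem_clinchingPolytope_iff hG hw).1 hξ).2.2 _ hu').2 T F hiT hTF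
      rw [Finset.sum_update_of_notMem hiT] at h1
      linarith

/-- The clinched amount can be added to any future of the other buyers. -/
theorem update_mem_futures (hG : G.IsPolymatroidal) {w : Fin N × Fin m → ℝ}
    (hw : w ∈ G.polytope) {d : Fin N → ℝ≥0∞} {i : Fin N} {ξ : Fin m → ℝ}
    (hξ : ξ ∈ G.clinchingPolytope w d i) {u : Fin N → ℝ} (hu : u ∈ G.futures w d {i}) :
    Function.update u i (∑ j, ξ j) ∈ G.futures w d ∅ := by
  obtain ⟨hξd, hξC⟩ := ((mem_clinchingPolytope_iff hG hw).1 hξ).2.2 u hu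
  obtain ⟨hui, h0, hd, -⟩ := mem_futures_singleton_iff.1 hu
  refine ⟨fun k => ?_, fun k => ?_, by simp, fun T F hTF => ?_⟩
  · by_cases hk : k = i
    · subst hk; simpa using sum_nonneg_of_clinch hξ
    · simpa [hk] using h0 k
  · by_cases hk : k = i
    · subst hk; simpa using hξd
    · simpa [hk] using hd k
  · have h1 := hξC (T.erase i) F (by simp) (fun e he => hTF e (Finset.mem_of_mem_erase he))
    rw [Finset.sum_erase _ hui] at h1
    have h2 := sum_update_add u T i (∑ j, ξ j)
    rw [hui, zero_add] at h2
    rw [h2]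
    split_ifs with hiT
    · rwa [sum_lift_of_forall_mem ξ (fun e he => hTF e (he ▸ hiT))] at h1
    · have h3 : 0 ≤ ∑ e ∈ F, lift i ξ e := Finset.sum_nonneg fun e _ => lift_nonneg hξ.1 e
      linarith

/-- Nothing is left to clinch after a maximal clinch: what could be clinched now could have been
added to the vector clinched before. -/
theorem eq_zero_of_clinch_after (hG : G.IsPolymatroidal) {w : Fin N × Fin m → ℝ}
    (hw : w ∈ G.polytope) {d : Fin N → ℝ≥0∞} {i : Fin N} {ξ : Fin m → ℝ}
    (hξ : Maximal (· ∈ G.clinchingPolytope w d i) ξ) {ζ : Fin m → ℝ}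
    (hζ : ζ ∈ G.clinchingPolytope (w + lift i ξ) (lower d i (∑ j, ξ j)) i) : ζ = 0 := by
  have hw' := polytope_of_clinch hG hw hξ.1
  have hlift : lift i (ξ + ζ) = lift i ξ + lift i ζ := by
    ext e; simp only [lift, Pi.add_apply]; split_ifs <;> simp
  have hmem : ξ + ζ ∈ G.clinchingPolytope w d i := by
    refine (mem_clinchingPolytope_iff hG hw).2 ⟨fun j => add_nonneg (hξ.1.1 j) (hζ.1 j),
      fun j hj => by simp [hξ.1.2.1 j hj, hζ.2.1 j hj], fun u hu => ?_⟩
    have hui : u i = 0 := hu.2.2.1 i (by simp)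
    have h1 := sub_mem_futures hG hw hξ.1 (update_mem_futures hG hw hξ.1 hu) (by simp) (by simp)
    simp only [Function.update_self, sub_self, Function.update_idem] at h1
    rw [← hui, Function.update_eq_self] at h1
    have h2 : u ∈ G.futures (w + lift i ξ) (lower d i (∑ j, ξ j)) {i} :=
      ⟨h1.1, h1.2.1, by simpa using hui, h1.2.2.2⟩
    obtain ⟨h3, h4⟩ := ((mem_clinchingPolytope_iff hG hw').1 hζ).2.2 u h2
    constructor
    · have h5 := clinch_le_demand hG hw hξ.1
      simp only [lower, Function.update_self] at h3
      simp only [Pi.add_apply, Finset.sum_add_distrib]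
      rw [ENNReal.ofReal_add (sum_nonneg_of_clinch hξ.1) (sum_nonneg_of_clinch hζ)]
      calc _ ≤ ENNReal.ofReal (∑ j, ξ j) + (d i - ENNReal.ofReal (∑ j, ξ j)) := by gcongr
        _ = d i := add_tsub_cancel_of_le h5
    · intro T F hiT hTF
      have h6 := h4 T F hiT hTF
      rw [residual_add] at h6
      rw [hlift]
      simp only [Pi.add_apply, Finset.sum_add_distrib]
      linarith
  have := hξ.2 hmem (fun j => by simpa using hζ.1 j)
  ext j
  have h7 := this j
  simp only [Pi.add_apply] at h7
  exact le_antisymm (by simpa using h7) (hζ.1 j)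

/-- All remaining goods can be sold without the help of the buyers in `Z`. -/
def Sellable (G : Market N m) (w : Fin N × Fin m → ℝ) (d : Fin N → ℝ≥0∞) (Z : Finset (Fin N)) :
    Prop :=
  ∃ u ∈ G.futures w d Z, ∑ k, u k = G.residual w Finset.univ

theorem covers_univ : Covers (Finset.univ : Finset (Fin N))
    (Finset.univ : Finset (Fin N × Fin m)) := by simp [Covers]

theorem Sellable.clinch (hG : G.IsPolymatroidal) {w : Fin N × Fin m → ℝ}
    (hw : w ∈ G.polytope) {d : Fin N → ℝ≥0∞} {i : Fin N} {ξ : Fin m → ℝ}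
    (hξ : ξ ∈ G.clinchingPolytope w d i) {Z : Finset (Fin N)} (h : G.Sellable w d Z)
    (hZ : i ∉ Z) : G.Sellable (w + lift i ξ) (lower d i (∑ j, ξ j)) Z := by
  obtain ⟨u, hu, hsum⟩ := h
  have hi : ∑ j, ξ j ≤ u i := by
    have hu' : Function.update u i 0 ∈ G.futures w d {i} := by
      refine mem_futures_singleton_iff.2 ⟨by simp, fun k => ?_, fun k => ?_, fun T F hiT hTF => ?_⟩
      · by_cases hk : k = i
        · subst hk; simp
        · simpa [hk] using hu.1 k
      · by_cases hk : k = i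
        · subst hk; simp
        · simpa [hk] using hu.2.1 k
      · rw [Finset.sum_update_of_notMem hiT]; exact hu.2.2.2 T F hTF
    have h1 := (update_mem_futures hG hw hξ hu').2.2.2 _ _ covers_univ
    have h2 := sum_update_add u Finset.univ i (∑ j, ξ j - u i)
    rw [Function.update_idem] at h1
    rw [add_sub_cancel, if_pos (Finset.mem_univ i)] at h2
    linarith
  refine ⟨_, sub_mem_futures hG hw hξ hu hZ hi, ?_⟩
  rw [sum_update_sub, residual_add, sum_lift_of_forall_mem ξ (by simp), if_pos (Finset.mem_univ i),
    hsum]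

theorem Covers.union {T T' : Finset (Fin N)} {F F' : Finset (Fin N × Fin m)} (h : Covers T F)
    (h' : Covers T' F') : Covers (T ∪ T') (F ∪ F') := fun e he => by
  rw [Finset.mem_union] at he ⊢; exact he.imp (h e) (h' e)

theorem Covers.inter {T T' : Finset (Fin N)} {F F' : Finset (Fin N × Fin m)} (h : Covers T F)
    (h' : Covers T' F') : Covers (T ∩ T') (F ∩ F') := fun e he => by
  rw [Finset.mem_inter] at he ⊢; exact he.imp (h e) (h' e)

/-- If buyer `i` with positive demand can clinch nothing, then each of her edges lies in a set of
edges that the other buyers can buy up. -/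
theorem exists_tight_of_no_clinch (hG : G.IsPolymatroidal) {w : Fin N × Fin m → ℝ}
    (hw : w ∈ G.polytope) {d : Fin N → ℝ≥0∞} {i : Fin N}
    (htriv : ∀ ζ ∈ G.clinchingPolytope w d i, ζ = 0) (hdi : d i ≠ 0) {j : Fin m}
    (hj : (i, j) ∈ G.E) : ∃ T F, ∃ u ∈ G.futures w d {i}, i ∉ T ∧ Covers T F ∧ (i, j) ∈ F ∧
      G.residual w F ≤ ∑ k ∈ T, u k := by
  by_contra! hno
  have hmax := fun S => exists_max_region Covers (G.residual w) d {i}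
    (fun _ F _ => residual_nonneg hG hw F) covers_univ S
  choose U hU hUmax using hmax
  obtain ⟨κ₁, hκ₁, hκC⟩ := exists_pos_le_of_finite
    (fun p : {p : Finset (Fin N) × Finset (Fin N × Fin m) //
      i ∉ p.1 ∧ Covers p.1 p.2 ∧ (i, j) ∈ p.2} => G.residual w p.1.2 - ∑ k ∈ p.1.1, U p.1.1 k)
    (fun p => sub_pos.2 (hno _ _ _ (hU _) p.2.1 p.2.2.1 p.2.2.2))
  obtain ⟨κ₂, hκ₂, hκd⟩ := exists_pos_ofReal_add_le (le_refl (0 : ℝ))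
    (d := d i) (by simpa using pos_iff_ne_zero.2 hdi)
  rw [zero_add] at hκd
  set κ := min κ₁ κ₂ with hκdef
  have hκ : 0 < κ := lt_min hκ₁ hκ₂
  have hmem : Pi.single j κ ∈ G.clinchingPolytope w d i := by
    refine (mem_clinchingPolytope_iff hG hw).2 ⟨fun j' => ?_, fun j' hj' => ?_, fun u hu => ⟨?_, ?_⟩⟩
    · by_cases h : j' = j
      · subst h; simpa using hκ.le
      · simp [h]
    · have : j' ≠ j := by rintro rfl; exact hj' hj
      simp [this]
    · simp only [Finset.sum_pi_single', Finset.mem_univ, if_true]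
      exact (ENNReal.ofReal_le_ofReal (min_le_right _ _)).trans hκd
    · intro T F hiT hTF
      have hl : ∑ e ∈ F, lift i (Pi.single j κ) e = if (i, j) ∈ F then κ else 0 := by
        have : lift i (Pi.single j κ) = Pi.single (i, j) κ := by
          ext ⟨a, b⟩
          by_cases ha : a = i <;> by_cases hb : b = j <;>
            simp [lift, ha, hb]
        rw [this, Finset.sum_pi_single']
      rw [hl]
      split_ifs with hF
      · have h1 := hκC ⟨(T, F), hiT, hTF, hF⟩
        have h2 := hUmax T u hu
        dsimp only at h1
        linarith [min_le_left κ₁ κ₂]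
      · simpa using hu.2.2.2 T F hTF
  have := congrFun (htriv _ hmem) j
  simp at this
  exact hκ.ne' this

/-- If buyer `i` can clinch nothing, then her demand is not needed to sell all goods. The tight
sets at her edges are uncrossed with a tight set of a largest future of the other buyers. -/
theorem Sellable.without (hG : G.IsPolymatroidal) {w : Fin N × Fin m → ℝ}
    (hw : w ∈ G.polytope) {d : Fin N → ℝ≥0∞} {i : Fin N}
    (htriv : ∀ ζ ∈ G.clinchingPolytope w d i, ζ = 0) (h : G.Sellable w d ∅) :
    G.Sellable w d {i} := by
  obtain ⟨u₀, hu₀, hsum₀⟩ := h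
  by_cases hdi : d i = 0
  · refine ⟨u₀, ⟨hu₀.1, hu₀.2.1, ?_, hu₀.2.2.2⟩, hsum₀⟩
    have := hu₀.2.1 i
    rw [hdi] at this
    simpa using le_antisymm (by simpa using this) (hu₀.1 i)
  obtain ⟨u, hu, hmax⟩ := exists_max_region Covers (G.residual w) d {i}
    (fun _ F _ => residual_nonneg hG hw F) covers_univ Finset.univ
  have hui : u i = 0 := hu.2.2.1 i (by simp)
  have key : ∀ S : Finset (Fin m), ∃ T F, i ∉ T ∧ Covers T F ∧ ∑ k ∈ T, u k = G.residual w F ∧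
      (∀ k, k ∉ T → k ≠ i → ENNReal.ofReal (u k) = d k) ∧ ∀ j ∈ S, (i, j) ∈ G.E → (i, j) ∈ F := by
    intro S
    induction S using Finset.induction_on with
    | empty =>
      obtain ⟨T, F, hTF, ht, hk⟩ := exists_tight_of_max (residual_submodular hG w)
        (residual_empty hG w) (by simp [Covers]) (fun _ _ _ _ => Covers.union)
        (fun _ _ _ _ => Covers.inter) hu hmax
      refine ⟨T.erase i, F, by simp, fun e he => hTF e (Finset.mem_of_mem_erase he), ?_, ?_, by simp⟩
      · rw [Finset.sum_erase _ hui, ht]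
      · intro k hkT hki
        exact hk k (fun h => hkT (Finset.mem_erase.2 ⟨hki, h⟩)) (by simpa using hki)
    | insert j S _ ih =>
      obtain ⟨T, F, hiT, hTF, ht, hk, hS⟩ := ih
      by_cases hj : (i, j) ∈ G.E
      · obtain ⟨T', F', u', hu', hiT', hTF', hjF', ht'⟩ :=
          exists_tight_of_no_clinch hG hw htriv hdi hj
        refine ⟨T ∪ T', F ∪ F', by simp [hiT, hiT'], hTF.union hTF', ?_, ?_, ?_⟩
        · refine le_antisymm (hu.2.2.2 _ _ (hTF.union hTF')) ?_
          have h1 := residual_submodular hG w F F'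
          have h2 := hu'.2.2.2 _ _ (hTF.inter hTF')
          have h3 : ∑ k ∈ T', u' k = ∑ k ∈ T' \ T, u' k + ∑ k ∈ T ∩ T', u' k := by
            rw [← Finset.sum_sdiff (Finset.inter_subset_right : T ∩ T' ⊆ T'),
              Finset.sdiff_inter_self_right]
          have h4 : ∑ k ∈ T' \ T, u' k ≤ ∑ k ∈ T' \ T, u k := Finset.sum_le_sum fun k hk' => by
            rw [Finset.mem_sdiff] at hk'
            have h5 := hk k hk'.2 (by rintro rfl; exact hiT' hk'.1)
            have h6 := hu'.2.1 k
            rw [← h5] at h6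
            exact (ENNReal.ofReal_le_ofReal_iff (hu.1 k)).1 h6
          have h7 : ∑ k ∈ T ∪ T', u k = ∑ k ∈ T' \ T, u k + ∑ k ∈ T, u k := by
            rw [← Finset.sum_sdiff (Finset.subset_union_left : T ⊆ T ∪ T'),
              Finset.union_sdiff_left]
          linarith
        · intro k hkT
          exact hk k (fun h => hkT (Finset.mem_union_left _ h))
        · intro j' hj' hE
          rcases Finset.mem_insert.1 hj' with rfl | hj'
          · exact Finset.mem_union_right _ hjF'
          · exact Finset.mem_union_left _ (hS j' hj' hE)
      · refine ⟨T, F, hiT, hTF, ht, hk, fun j' hj' hE => ?_⟩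
        rcases Finset.mem_insert.1 hj' with rfl | hj'
        exacts [absurd hE hj, hS j' hj' hE]
  obtain ⟨T, F, hiT, hTF, ht, hk, hF⟩ := key Finset.univ
  have hres : G.residual w (F ∪ fiber m {i}) = G.residual w F := by
    refine residual_congr hw.2.1 ?_
    ext ⟨a, b⟩
    simp only [Finset.mem_inter, Finset.mem_union, mem_fiber, Finset.mem_singleton]
    constructor
    · rintro ⟨h | rfl, hE⟩
      exacts [⟨h, hE⟩, ⟨hF b (Finset.mem_univ b) hE, hE⟩]
    · exact fun ⟨h, hE⟩ => ⟨Or.inl h, hE⟩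
  have hcov : Covers (insert i T) (F ∪ fiber m {i}) := fun e he => by
    rcases Finset.mem_insert.1 he with he | he
    · exact Finset.mem_union_right _ (by simpa using he)
    · exact Finset.mem_union_left _ (hTF e he)
  refine ⟨u, hu, le_antisymm (hu.2.2.2 _ _ covers_univ) ?_⟩
  rw [← hsum₀, ← Finset.sum_add_sum_compl (insert i T), ← Finset.sum_add_sum_compl (insert i T)]
  refine add_le_add ?_ (Finset.sum_le_sum fun k hk' => ?_)
  · rw [Finset.sum_insert (f := u) hiT, hui, zero_add, ht, ← hres]
    exact hu₀.2.2.2 _ _ hcov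
  · simp only [Finset.mem_compl, Finset.mem_insert, not_or] at hk'
    have h6 := hu₀.2.1 k
    rw [← hk k hk'.2 hk'.1] at h6
    exact (ENNReal.ofReal_le_ofReal_iff (hu.1 k)).1 h6

/-- The futures depend only on the amounts that the buyers have obtained: they are described by
the bounds for the full sets of edges of groups of buyers. -/
def Aggregated (G : Market N m) (w : Fin N × Fin m → ℝ) (d : Fin N → ℝ≥0∞) : Prop :=
  region IsFiber (G.residual w) d ∅ ⊆ G.futures w d ∅

theorem Aggregated.clinch (hG : G.IsPolymatroidal) {w : Fin N × Fin m → ℝ}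
    (hw : w ∈ G.polytope) {d : Fin N → ℝ≥0∞} {i : Fin N} {ξ : Fin m → ℝ}
    (hξ : ξ ∈ G.clinchingPolytope w d i) (h : G.Aggregated w d) :
    G.Aggregated (w + lift i ξ) (lower d i (∑ j, ξ j)) := by
  rintro u ⟨h0, hd, -, hC⟩
  have hδ := sum_nonneg_of_clinch hξ
  have hmem : Function.update u i (u i + ∑ j, ξ j) ∈ G.futures w d ∅ := by
    refine h ⟨fun k => ?_, fun k => ?_, by simp, ?_⟩
    · by_cases hk : k = i
      · subst hk; simpa using add_nonneg (h0 k) hδ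
      · simpa [hk] using h0 k
    · by_cases hk : k = i
      · subst hk
        have h1 := hd k
        simp only [lower, Function.update_self] at h1 ⊢
        rw [ENNReal.ofReal_add (h0 k) hδ]
        calc _ ≤ (d k - ENNReal.ofReal (∑ j, ξ j)) + ENNReal.ofReal (∑ j, ξ j) := by gcongr
          _ = d k := tsub_add_cancel_of_le (clinch_le_demand hG hw hξ)
      · simpa [lower, hk] using hd k
    · rintro T _ rfl
      have h1 := hC T _ rfl
      rw [residual_add] at h1
      rw [sum_update_add]
      split_ifs with hiT
      · rw [sum_lift_of_forall_mem ξ (by simp [hiT])] at h1; linarith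
      · rw [sum_lift_fiber_of_notMem ξ hiT] at h1; linarith
  have h2 := sub_mem_futures hG hw hξ hmem (by simp) (by simpa using h0 i)
  simpa using h2

/-- The set `T` certifies that the other buyers outside `T` can only just absorb what is left
beside the supply for `T`, so that `k` cannot obtain more. Their demands are bounded by reals. -/
def Cert (G : Market N m) (w : Fin N × Fin m → ℝ) (d : Fin N → ℝ≥0∞) (k : Fin N)
    (T : Finset (Fin N)) : Prop :=
  k ∉ T ∧ ∃ b : Fin N → ℝ, (∀ j, 0 ≤ b j) ∧ (∀ j, j ∉ T → j ≠ k → d j ≤ ENNReal.ofReal (b j)) ∧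
    G.residual w (fiber m T) + ∑ j ∈ (insert k T)ᶜ, b j ≤ G.residual w Finset.univ

/-- A buyer who clinches something has a certifying set afterwards: a largest future of the other
buyers falls short of the whole supply, and its tight set is the certificate. -/
theorem exists_cert_of_clinch (hG : G.IsPolymatroidal) {w : Fin N × Fin m → ℝ}
    (hw : w ∈ G.polytope) {d : Fin N → ℝ≥0∞} {k : Fin N} {ξ : Fin m → ℝ}
    (hξ : ξ ∈ G.clinchingPolytope w d k) (hpos : 0 < ∑ j, ξ j) (hagg : G.Aggregated w d)
    (hsell : G.Sellable w d ∅) :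
    ∃ T, G.Cert (w + lift k ξ) (lower d k (∑ j, ξ j)) k T := by
  obtain ⟨u, hu, hmax⟩ := exists_max_region IsFiber (G.residual w) d {k}
    (fun _ F _ => residual_nonneg hG hw F) (by ext; simp) Finset.univ
  obtain ⟨T, _, rfl, ht, hsat⟩ := exists_tight_of_max (residual_submodular hG w)
    (residual_empty hG w) (by ext; simp) (by rintro T _ T' _ rfl rfl; ext; simp)
    (by rintro T _ T' _ rfl rfl; ext; simp) hu hmax
  have huk : u k = 0 := hu.2.2.1 k (by simp)
  have hfut : u ∈ G.futures w d {k} := by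
    have := hagg ⟨hu.1, hu.2.1, by simp, hu.2.2.2⟩
    exact ⟨this.1, this.2.1, hu.2.2.1, this.2.2.2⟩
  have hclinch : ∑ j, u j + ∑ j, ξ j ≤ G.residual w Finset.univ := by
    have h1 := (update_mem_futures hG hw hξ hfut).2.2.2 _ _ covers_univ
    have h2 := sum_update_add u Finset.univ k (∑ j, ξ j)
    rw [huk, zero_add, if_pos (Finset.mem_univ k)] at h2
    rwa [h2] at h1
  have hkT : k ∉ T := by
    intro hkT
    obtain ⟨u₀, hu₀, hsum₀⟩ := hsell
    have h1 : ∑ j, u₀ j ≤ ∑ j, u j := by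
      rw [← Finset.sum_add_sum_compl T, ← Finset.sum_add_sum_compl T]
      refine add_le_add ?_ (Finset.sum_le_sum fun j hj => ?_)
      · rw [ht]; exact hu₀.2.2.2 _ _ (fun e he => mem_fiber.2 he)
      · rw [Finset.mem_compl] at hj
        have h6 := hu₀.2.1 j
        rw [← hsat j hj (by rw [Finset.mem_singleton]; rintro rfl; exact hj hkT)] at h6
        exact (ENNReal.ofReal_le_ofReal_iff (hu.1 j)).1 h6
    linarith
  refine ⟨T, hkT, u, hu.1, fun j hjT hjk => ?_, ?_⟩
  · simp only [lower, Function.update_of_ne hjk]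
    exact (hsat j hjT (by simpa using hjk)).ge
  · rw [residual_add, residual_add, sum_lift_fiber_of_notMem ξ hkT,
      sum_lift_of_forall_mem ξ (by simp), ← ht]
    have h1 := Finset.sum_add_sum_compl (insert k T) u
    rw [Finset.sum_insert hkT, huk] at h1
    linarith

theorem Cert.clinch (hG : G.IsPolymatroidal) {w : Fin N × Fin m → ℝ}
    (hw : w ∈ G.polytope) {d : Fin N → ℝ≥0∞} {i k : Fin N} {ξ : Fin m → ℝ}
    (hξ : ξ ∈ G.clinchingPolytope w d i) {T : Finset (Fin N)} (h : G.Cert w d k T)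
    (hik : i ≠ k ∨ ∑ j, ξ j = 0) :
    G.Cert (w + lift i ξ) (lower d i (∑ j, ξ j)) k T := by
  obtain ⟨hkT, b, hb0, hbd, hb⟩ := h
  have hδ := sum_nonneg_of_clinch hξ
  have hle : ∀ j, lower d i (∑ j, ξ j) j ≤ d j := fun j => by
    unfold lower
    by_cases hj : j = i
    · subst hj; simp
    · simp [hj]
  refine ⟨hkT, ?_⟩
  rw [residual_add, residual_add, sum_lift_of_forall_mem ξ (F := Finset.univ) (by simp)]
  by_cases hiT : i ∈ T
  · refine ⟨b, hb0, fun j hjT hjk => (hle j).trans (hbd j hjT hjk), ?_⟩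
    rw [sum_lift_of_forall_mem ξ (F := fiber m T) (by simp [hiT])]
    linarith
  · rw [sum_lift_fiber_of_notMem ξ hiT]
    rcases eq_or_ne i k with rfl | hik'
    · have h0 := hik.resolve_left (by simp)
      exact ⟨b, hb0, fun j hjT hjk => (hle j).trans (hbd j hjT hjk), by rw [h0]; linarith⟩
    · have hib : ∑ j, ξ j ≤ b i := (ENNReal.ofReal_le_ofReal_iff (hb0 i)).1
        ((clinch_le_demand hG hw hξ).trans (hbd i hiT hik'))
      refine ⟨Function.update b i (b i - ∑ j, ξ j), fun j => ?_, fun j hjT hjk => ?_, ?_⟩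
      · by_cases hj : j = i
        · subst hj; simpa using hib
        · simpa [hj] using hb0 j
      · by_cases hj : j = i
        · subst hj
          simp only [lower, Function.update_self]
          rw [ENNReal.ofReal_sub _ hδ]
          exact tsub_le_tsub_right (hbd j hjT hjk) _
        · simpa [lower, hj] using hbd j hjT hjk
      · rw [sum_update_sub, if_pos (by simp [hiT, hik'])]
        linarith

/-- When `k` has no demand left and the demand of `i` is not needed, a buyer `i` outside a
certifying set has no demand left either. -/
theorem Cert.demand_eq_zero {w : Fin N × Fin m → ℝ} {d : Fin N → ℝ≥0∞} {i k : Fin N}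
    {T : Finset (Fin N)} (h : G.Cert w d k T) (hdk : d k = 0) (hsell : G.Sellable w d {i})
    (hiT : i ∉ T) (hik : i ≠ k) : d i = 0 := by
  obtain ⟨hkT, b, hb0, hbd, hb⟩ := h
  obtain ⟨u, hu, hsum⟩ := hsell
  have hui : u i = 0 := hu.2.2.1 i (by simp)
  have huk : u k = 0 := by
    have := hu.2.1 k
    rw [hdk] at this
    exact le_antisymm (by simpa using this) (hu.1 k)
  have h1 := Finset.sum_add_sum_compl (insert k T) u
  rw [Finset.sum_insert hkT, huk] at h1
  have h2 := hu.2.2.2 T (fiber m T) (fun e he => mem_fiber.2 he)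
  have hmem : i ∈ (insert k T)ᶜ := by simp [hiT, hik]
  have h3 : ∑ j ∈ (insert k T)ᶜ, u j + b i ≤ ∑ j ∈ (insert k T)ᶜ, b j := by
    rw [← Finset.add_sum_erase _ _ hmem, ← Finset.add_sum_erase _ b hmem, hui]
    have : ∑ j ∈ (insert k T)ᶜ.erase i, u j ≤ ∑ j ∈ (insert k T)ᶜ.erase i, b j := by
      refine Finset.sum_le_sum fun j hj => ?_
      simp only [Finset.mem_erase, Finset.mem_compl, Finset.mem_insert, not_or] at hj
      exact (ENNReal.ofReal_le_ofReal_iff (hb0 j)).1 ((hu.2.1 j).trans (hbd j hj.2.2 hj.2.1))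
    linarith
  have h4 : b i ≤ 0 := by linarith
  have h5 := hbd i hiT hik
  rw [ENNReal.ofReal_eq_zero.2 h4] at h5
  exact le_antisymm h5 bot_le

end Market

/-! ### Invariants of the auction -/

namespace Market

variable {N m : ℕ} {G : Market N m}

theorem Aggregated.mono {w : Fin N × Fin m → ℝ} {d d' : Fin N → ℝ≥0∞}
    (hagg : G.Aggregated w d) (h : d' ≤ d) : G.Aggregated w d' := by
  rintro u ⟨h0, hd, hZ, hC⟩
  have := hagg ⟨h0, fun k => (hd k).trans (h k), hZ, hC⟩
  exact ⟨h0, hd, hZ, this.2.2.2⟩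

theorem Cert.mono {w : Fin N × Fin m → ℝ} {d d' : Fin N → ℝ≥0∞} {k : Fin N} {T : Finset (Fin N)}
    (hc : G.Cert w d k T) (h : d' ≤ d) : G.Cert w d' k T := by
  obtain ⟨hk, b, hb0, hbd, hb⟩ := hc
  exact ⟨hk, b, hb0, fun j hj hjk => (h j).trans (hbd j hj hjk), hb⟩

end Market

namespace AuctionState

open Market

variable {N m : ℕ} {G : Market N m} {v : Fin N → ℝ} {B : Fin N → ℝ≥0∞} {ε : ℝ}

theorem buy_w (s : AuctionState N m) (i : Fin N) (ξ : Fin m → ℝ) :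
    (s.buy i ξ).w = s.w + lift i ξ := by
  ext e; simp only [buy, lift, Pi.add_apply]; split_ifs <;> simp

theorem demand_buy {s : AuctionState N m} {i : Fin N} {ξ : Fin m → ℝ} (hc : 0 ≤ s.c i)
    (hp : 0 ≤ s.p i) (hξ : 0 ≤ ∑ j, ξ j) (hd : ENNReal.ofReal (∑ j, ξ j) ≤ s.demand v B i) :
    (s.buy i ξ).demand v B = lower (s.demand v B) i (∑ j, ξ j) := by
  ext1 k
  unfold lower
  by_cases hk : k = i
  · subst hk
    rw [Function.update_self]
    unfold demand at hd ⊢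
    simp only [buy, Function.update_self]
    split_ifs with h1 h2
    · simp
    · have hc' : 0 < s.c k := lt_of_le_of_ne hc (Ne.symm h1)
      have hc0 : ENNReal.ofReal (s.c k) ≠ 0 := by simpa using hc'
      rw [ENNReal.ofReal_add hp (mul_nonneg hc hξ), ← tsub_tsub, ENNReal.ofReal_mul hc,
        ENNReal.sub_div (fun _ _ => hc0), mul_comm (ENNReal.ofReal (s.c k)),
        ENNReal.mul_div_cancel_right hc0 ENNReal.ofReal_ne_top]
    · simp
  · rw [Function.update_of_ne hk]
    unfold demand
    simp [buy, hk]

theorem budget_le_of_demand_eq_zero {s : AuctionState N m} {i : Fin N}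
    (hd : s.demand v B i = 0) (hc : s.c i < v i) : B i ≤ ENNReal.ofReal (s.p i) := by
  unfold demand at hd
  rw [if_pos hc] at hd
  split_ifs at hd with h1
  · exact absurd hd ENNReal.top_ne_zero
  · rw [ENNReal.div_eq_zero_iff] at hd
    exact tsub_eq_zero_iff_le.1 (hd.resolve_right ENNReal.ofReal_ne_top)

theorem demand_eq_zero {s : AuctionState N m} {i : Fin N} (hv : 0 < v i) (hc : v i ≤ s.c i) :
    s.demand v B i = 0 := by
  unfold demand
  rw [if_neg (hv.trans_le hc).ne', if_neg hc.not_gt]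

/-- The properties of a state that hold throughout the auction. In particular, every buyer who has
obtained something has a certifying set. -/
structure Inv (G : Market N m) (v : Fin N → ℝ) (B : Fin N → ℝ≥0∞) (s : AuctionState N m) :
    Prop where
  poly : s.w ∈ G.polytope
  c_nonneg : ∀ i, 0 ≤ s.c i
  p_nonneg : ∀ i, 0 ≤ s.p i
  p_le : ∀ i, s.p i ≤ v i * G.amount s.w i
  agg : G.Aggregated s.w (s.demand v B)
  sell : G.Sellable s.w (s.demand v B) ∅
  cert : ∀ k, 0 < G.amount s.w k → ∃ T, G.Cert s.w (s.demand v B) k T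

/-- The relations between a state and a later state of the same round of clinching. -/
structure SameRound (G : Market N m) (v : Fin N → ℝ) (B : Fin N → ℝ≥0∞)
    (s t : AuctionState N m) : Prop where
  c_eq : t.c = s.c
  l_eq : t.l = s.l
  p_le : ∀ i, s.p i ≤ t.p i
  sell : ∀ k, G.Sellable s.w (s.demand v B) {k} → G.Sellable t.w (t.demand v B) {k}
  amount : ∀ k, s.demand v B k = 0 → G.amount t.w k = G.amount s.w k
  demand : ∀ k, s.demand v B k = 0 → t.demand v B k = 0
  cert : ∀ k T, s.demand v B k = 0 → G.Cert s.w (s.demand v B) k T →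
    G.Cert t.w (t.demand v B) k T

theorem SameRound.refl (s : AuctionState N m) : SameRound G v B s s :=
  ⟨rfl, rfl, fun _ => le_rfl, fun _ => id, fun _ _ => rfl, fun _ => id, fun _ _ _ => id⟩

theorem SameRound.trans {s t t' : AuctionState N m} (h : SameRound G v B s t)
    (h' : SameRound G v B t t') : SameRound G v B s t' :=
  ⟨h'.c_eq.trans h.c_eq, h'.l_eq.trans h.l_eq, fun i => (h.p_le i).trans (h'.p_le i),
    fun k hk => h'.sell k (h.sell k hk),
    fun k hk => (h'.amount k (h.demand k hk)).trans (h.amount k hk),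
    fun k hk => h'.demand k (h.demand k hk),
    fun k T hk hc => h'.cert k T (h.demand k hk) (h.cert k T hk hc)⟩

theorem amount_buy {s : AuctionState N m} {i : Fin N} {ξ : Fin m → ℝ}
    (h : ∀ j, (i, j) ∉ G.E → ξ j = 0) (k : Fin N) :
    G.amount (s.buy i ξ).w k = G.amount s.w k + if k = i then ∑ j, ξ j else 0 := by
  rw [buy_w, amount_add, amount_lift h]

/-- A maximal clinch preserves the invariants, and makes the clinching buyer dispensable for
selling the remaining goods. -/
theorem Clinch.step (hG : G.IsPolymatroidal) (hv : ∀ i, 0 < v i) {s t : AuctionState N m}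
    {i : Fin N} (hs : Inv G v B s) (h : Clinch G v B i s t) :
    Inv G v B t ∧ SameRound G v B s t ∧ G.Sellable t.w (t.demand v B) {i} := by
  obtain ⟨ξ, hmax, rfl⟩ := h
  have hξ := hmax.1
  have hδ := sum_nonneg_of_clinch hξ
  have hd := clinch_le_demand hG hs.poly hξ
  have hdem := demand_buy (B := B) (v := v) (hs.c_nonneg i) (hs.p_nonneg i) hδ hd
  have hw := polytope_of_clinch hG hs.poly hξ
  have hzero : s.demand v B i = 0 → ∑ j, ξ j = 0 := fun h0 => by
    rw [h0] at hd
    exact le_antisymm (by simpa using hd) hδ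
  have hcert : ∀ k T, (i ≠ k ∨ ∑ j, ξ j = 0) → G.Cert s.w (s.demand v B) k T →
      G.Cert (s.buy i ξ).w ((s.buy i ξ).demand v B) k T := fun k T hik hc => by
    rw [buy_w, hdem]; exact hc.clinch hG hs.poly hξ hik
  refine ⟨⟨?_, hs.c_nonneg, fun k => ?_, fun k => ?_, ?_, ?_, fun k hk => ?_⟩,
    ⟨rfl, rfl, fun k => ?_, fun k hk => ?_, fun k hk => ?_, fun k hk => ?_, fun k T hk hc => ?_⟩, ?_⟩
  · rwa [buy_w]
  · by_cases hk : k = i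
    · subst hk
      simpa [buy] using add_nonneg (hs.p_nonneg k) (mul_nonneg (hs.c_nonneg k) hδ)
    · simpa [buy, hk] using hs.p_nonneg k
  · rw [amount_buy hξ.2.1]
    by_cases hk : k = i
    · subst hk
      -- a positive amount is bought only at a price below the valuation
      have : s.c k * ∑ j, ξ j ≤ v k * ∑ j, ξ j := by
        rcases lt_or_ge (s.c k) (v k) with hc | hc
        · exact mul_le_mul_of_nonneg_right hc.le hδ
        · rw [hzero (demand_eq_zero (hv k) hc)]; simp
      have h2 := hs.p_le k
      simp only [buy, Function.update_self, if_true]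
      linarith
    · simpa [buy, hk] using hs.p_le k
  · rw [buy_w, hdem]; exact hs.agg.clinch hG hs.poly hξ
  · rw [buy_w, hdem]; exact hs.sell.clinch hG hs.poly hξ (by simp)
  · rw [amount_buy hξ.2.1] at hk
    by_cases hik : i ≠ k ∨ ∑ j, ξ j = 0
    · have : 0 < G.amount s.w k := by
        split_ifs at hk with hki
        · rcases hik with h' | h'
          · exact absurd hki.symm h'
          · linarith
        · linarith
      obtain ⟨T, hT⟩ := hs.cert k this
      exact ⟨T, hcert k T hik hT⟩
    · push Not at hik
      obtain ⟨rfl, hne⟩ := hik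
      rw [buy_w, hdem]
      exact exists_cert_of_clinch hG hs.poly hξ (lt_of_le_of_ne hδ hne.symm) hs.agg hs.sell
  · by_cases hk : k = i
    · subst hk; simpa [buy] using mul_nonneg (hs.c_nonneg k) hδ
    · simp [buy, hk]
  · by_cases hki : k = i
    · subst hki
      rw [buy_w, hdem]
      exact (hs.sell.clinch hG hs.poly hξ (by simp)).without hG hw
        fun ζ hζ => eq_zero_of_clinch_after hG hs.poly hmax hζ
    · rw [buy_w, hdem]; exact hk.clinch hG hs.poly hξ (by simpa using Ne.symm hki)
  · rw [amount_buy hξ.2.1]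
    split_ifs with hki
    · rw [hzero (hki ▸ hk), add_zero]
    · rw [add_zero]
  · rw [hdem]
    unfold lower
    by_cases hki : k = i
    · subst hki; simp [hk]
    · simpa [hki] using hk
  · refine hcert k T ?_ hc
    by_cases hki : i = k
    · exact Or.inr (hzero (hki ▸ hk))
    · exact Or.inl hki
  · rw [buy_w, hdem]
    exact (hs.sell.clinch hG hs.poly hξ (by simp)).without hG hw
      fun ζ hζ => eq_zero_of_clinch_after hG hs.poly hmax hζ

theorem ClinchList.round (hG : G.IsPolymatroidal) (hv : ∀ i, 0 < v i) {L : List (Fin N)}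
    {s t : AuctionState N m} (hs : Inv G v B s) (h : ClinchList G v B L s t) :
    Inv G v B t ∧ SameRound G v B s t ∧ ∀ i ∈ L, G.Sellable t.w (t.demand v B) {i} := by
  induction L generalizing s with
  | nil => obtain rfl : t = s := h; exact ⟨hs, SameRound.refl _, by simp⟩
  | cons i L ih =>
    obtain ⟨s', h1, h2⟩ := h
    obtain ⟨hs', hr, hi⟩ := h1.step hG hv hs
    obtain ⟨ht, hr', hL⟩ := ih hs' h2
    refine ⟨ht, hr.trans hr', fun k hk => ?_⟩
    rcases List.mem_cons.1 hk with rfl | hk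
    exacts [hr'.sell _ hi, hL k hk]

theorem exists_clinchList (hG : G.IsPolymatroidal) (hv : ∀ i, 0 < v i) (L : List (Fin N))
    {s : AuctionState N m} (hs : Inv G v B s) : ∃ t, ClinchList G v B L s t := by
  induction L generalizing s with
  | nil => exact ⟨s, rfl⟩
  | cons i L ih =>
    obtain ⟨ξ, hξ⟩ := exists_maximal_clinch hG hs.poly (s.demand v B) i
    have hc : Clinch G v B i s (s.buy i ξ) := ⟨ξ, hξ, rfl⟩
    obtain ⟨t, ht⟩ := ih (hc.step hG hv hs).1
    exact ⟨t, _, hc, ht⟩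

theorem demand_tick_of_ne (t : AuctionState N m) {i : Fin N} (hi : (i : ℕ) ≠ t.l) :
    (t.tick ε).demand v B i = t.demand v B i := by
  simp [demand, tick, hi]

theorem demand_tick_le (hε : 0 < ε) {t : AuctionState N m} (hc : ∀ i, 0 ≤ t.c i) :
    (t.tick ε).demand v B ≤ t.demand v B := by
  intro i
  by_cases hi : (i : ℕ) = t.l
  · have hci : (t.tick ε).c i = t.c i + ε := by simp [tick, hi]
    have hpos : 0 < t.c i + ε := add_pos_of_nonneg_of_pos (hc i) hε
    unfold demand
    rw [hci, if_neg hpos.ne']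
    split_ifs with h1 h2 h3 h3
    · exact le_top
    · exact ENNReal.div_le_div_left (ENNReal.ofReal_le_ofReal (by linarith)) _
    · linarith
    · exact bot_le
    · exact bot_le
    · exact bot_le
  · exact (demand_tick_of_ne t hi).le

theorem Inv.tick (hε : 0 < ε) {t : AuctionState N m} (ht : Inv G v B t)
    (hsell : ∀ i, G.Sellable t.w (t.demand v B) {i}) (hl : t.l < N) :
    Inv G v B (t.tick ε) := by
  have hle := demand_tick_le (v := v) (B := B) hε ht.c_nonneg
  refine ⟨ht.poly, fun i => ?_, ht.p_nonneg, ht.p_le, ht.agg.mono hle, ?_, fun k hk => ?_⟩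
  · simp only [AuctionState.tick]
    have := ht.c_nonneg i
    split_ifs <;> linarith
  · obtain ⟨u, hu, hsum⟩ := hsell ⟨t.l, hl⟩
    refine ⟨u, ⟨hu.1, fun k => ?_, by simp, hu.2.2.2⟩, hsum⟩
    by_cases hk : (k : ℕ) = t.l
    · rw [hu.2.2.1 k (by simp [Fin.ext_iff, hk])]; simp
    · rw [demand_tick_of_ne t hk]; exact hu.2.1 k
  · obtain ⟨T, hT⟩ := ht.cert k hk
    exact ⟨T, hT.mono hle⟩

/-- The clocks of the buyers before `l` are one step ahead of the others. -/
def Synced (ε : ℝ) (s : AuctionState N m) (q : ℕ) : Prop :=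
  s.l < N ∧ ∀ i : Fin N, s.c i = (if (i : ℕ) < s.l then q + 1 else q) * ε

theorem Synced.tick {t : AuctionState N m} {q : ℕ} (h : Synced ε t q) :
    ∃ q', Synced ε (t.tick ε) q' := by
  obtain ⟨hl, hc⟩ := h
  rcases Nat.lt_or_ge (t.l + 1) N with h1 | h1
  · refine ⟨q, ?_, fun i => ?_⟩
    · simpa [AuctionState.tick, Nat.mod_eq_of_lt h1] using h1
    · simp only [AuctionState.tick, Nat.mod_eq_of_lt h1, hc]
      rcases lt_trichotomy (i : ℕ) t.l with h2 | h2 | h2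
      · simp [h2, h2.ne, Nat.lt_succ_of_lt h2]
      · simp [h2]; ring
      · simp [h2.ne', h2.not_gt, Nat.not_lt.2 (Nat.succ_le_of_lt h2)]
  · have h2 : t.l + 1 = N := le_antisymm hl h1
    refine ⟨q + 1, ?_, fun i => ?_⟩
    · simp [AuctionState.tick, h2]; omega
    · simp only [AuctionState.tick, h2, Nat.mod_self, hc]
      have h3 : (i : ℕ) ≤ t.l := by omega
      rcases h3.lt_or_eq with h4 | h4
      · simp [h4, h4.ne]
      · simp [h4]; ring

/-- The certifying set of buyer `k` can be chosen such that, once `k` has dropped out, all buyers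
of higher valuation outside of it have exhausted their budgets. -/
def Certified (G : Market N m) (v : Fin N → ℝ) (B : Fin N → ℝ≥0∞) (s : AuctionState N m) : Prop :=
  ∀ k, 0 < G.amount s.w k → ∃ T, G.Cert s.w (s.demand v B) k T ∧ ((∀ i, s.c i ≤ v k) ∨
    (v k ≤ s.c k ∧ ∀ i, i ∉ T → v k < v i → B i ≤ ENNReal.ofReal (s.p i)))

theorem Synced.bounds (hε : 0 < ε) {s : AuctionState N m} {q : ℕ} (h : Synced ε s q)
    (i : Fin N) : q * ε ≤ s.c i ∧ s.c i ≤ (q + 1) * ε := by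
  rw [h.2 i]
  split_ifs <;> push_cast <;> constructor <;> nlinarith

theorem Synced.succ_mul_le (hε : 0 < ε) {s : AuctionState N m} {q : ℕ} (h : Synced ε s q)
    {k : Fin N} {x : ℝ} (hx : ∃ a : ℕ, x = a * ε) (hk : s.c k < x) : (q + 1) * ε ≤ x := by
  obtain ⟨a, rfl⟩ := hx
  have h1 := (h.bounds hε k).1.trans_lt hk
  rw [mul_lt_mul_iff_left₀ hε, Nat.cast_lt] at h1
  refine mul_le_mul_of_nonneg_right ?_ hε.le
  exact_mod_cast h1

theorem Certified.round (hv : ∀ i, 0 < v i) (hε : 0 < ε) (hvε : ∀ i, ∃ a : ℕ, v i = a * ε)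
    {s t : AuctionState N m} {q : ℕ} (hq : Synced ε s q) (hs : Certified G v B s)
    (ht : Inv G v B t) (h : SameRound G v B s t) : Certified G v B t := by
  intro k hk
  rcases le_or_gt (v k) (s.c k) with hc | hc
  · have hd := demand_eq_zero (B := B) (hv k) hc
    rw [h.amount k hd] at hk
    obtain ⟨T, hT, hor⟩ := hs k hk
    refine ⟨T, h.cert k T hd hT, ?_⟩
    rw [h.c_eq]
    exact hor.imp id fun h' => ⟨h'.1, fun i hi hvi =>
      (h'.2 i hi hvi).trans (ENNReal.ofReal_le_ofReal (h.p_le i))⟩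
  · obtain ⟨T, hT⟩ := ht.cert k hk
    refine ⟨T, hT, Or.inl ?_⟩
    rw [h.c_eq]
    exact fun i => (hq.bounds hε i).2.trans (hq.succ_mul_le hε (hvε k) hc)

theorem Certified.tick (hv : ∀ i, 0 < v i) (hε : 0 < ε) (hvε : ∀ i, ∃ a : ℕ, v i = a * ε)
    {t : AuctionState N m} {q : ℕ} (hq : Synced ε t q) (hs : Certified G v B t)
    (ht : Inv G v B t) (hsell : ∀ i, G.Sellable t.w (t.demand v B) {i}) :
    Certified G v B (t.tick ε) := by
  intro k hk
  obtain ⟨T, hT, hor⟩ := hs k hk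
  have hle : ∀ i, t.c i ≤ (t.tick ε).c i := fun i => by
    simp only [AuctionState.tick]; split_ifs <;> linarith
  refine ⟨T, hT.mono (demand_tick_le hε ht.c_nonneg), ?_⟩
  rcases hor with hall | ⟨h1, h2⟩
  · by_cases hlt : ∀ i, (t.tick ε).c i ≤ v k
    · exact Or.inl hlt
    right
    -- otherwise `k` has just dropped out, and all clocks show at least her valuation
    have hvk : v k ≤ t.c k := by
      by_contra! hck
      refine hlt fun i => ?_
      simp only [AuctionState.tick]
      split_ifs with hi
      · rw [hq.2 i, if_neg hi.not_lt]
        linarith [hq.succ_mul_le hε (hvε k) hck]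
      · exact hall i
    refine ⟨hvk.trans (hle k), fun i hiT hvi => ?_⟩
    have hik : i ≠ k := by rintro rfl; exact lt_irrefl _ hvi
    exact budget_le_of_demand_eq_zero (s := t)
      (hT.demand_eq_zero (demand_eq_zero (hv k) hvk) (hsell i) hiT hik)
      ((hall i).trans_lt hvi)
  · exact Or.inr ⟨h1.trans (hle k), h2⟩

/-- The properties that hold whenever the main loop is about to start a new pass. -/
structure LoopInv (G : Market N m) (v : Fin N → ℝ) (B : Fin N → ℝ≥0∞) (ε : ℝ)
    (s : AuctionState N m) : Prop where
  inv : Inv G v B s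
  synced : ∃ q, Synced ε s q
  certified : Certified G v B s

theorem LoopInv.init (hG : G.IsPolymatroidal) (hN : 0 < N) : LoopInv G v B ε init := by
  have hd : (AuctionState.init : AuctionState N m).demand v B = fun _ => ⊤ := by
    ext; simp [demand, AuctionState.init]
  have hw : (0 : Fin N × Fin m → ℝ) ∈ G.polytope := by
    rw [mem_polytope_iff hG]
    refine ⟨by simp, by simp, fun F => ?_⟩
    simpa [totalF_empty hG] using totalF_mono hG (Finset.empty_subset F)
  have ha : ∀ k, G.amount (0 : Fin N × Fin m → ℝ) k = 0 := fun k => by simp [amount]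
  refine ⟨⟨hw, fun _ => le_rfl, fun _ => le_rfl, fun k => ?_, ?_, ?_, fun k hk => ?_⟩,
    ⟨0, hN, fun i => ?_⟩, fun k hk => ?_⟩
  · simp [AuctionState.init, ha]
  · rw [hd]
    rintro u ⟨h0, hu, hZ, hC⟩
    refine ⟨h0, hu, hZ, fun T F hTF => (hC T _ rfl).trans ?_⟩
    simpa [Market.residual, AuctionState.init] using
      totalF_mono hG (fun e he => hTF e (mem_fiber.1 he))
  · rw [hd]
    obtain ⟨u, hu, hmax⟩ := exists_max_region Covers (G.residual 0) (fun _ => ⊤) ∅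
      (fun _ F _ => residual_nonneg hG hw F) covers_univ Finset.univ
    obtain ⟨T, F, hTF, ht, hk⟩ := exists_tight_of_max (residual_submodular hG 0)
      (residual_empty hG 0) (by simp [Covers]) (fun _ _ _ _ => Covers.union)
      (fun _ _ _ _ => Covers.inter) hu hmax
    have hT : T = Finset.univ := by
      ext k
      simp only [Finset.mem_univ, iff_true]
      by_contra hkT
      exact ENNReal.ofReal_ne_top (hk k hkT (by simp))
    subst hT
    have hF : F = Finset.univ := by
      ext e; simp only [Finset.mem_univ, iff_true]; exact hTF e (Finset.mem_univ _)
    subst hF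
    exact ⟨u, hu, ht⟩
  · simp [AuctionState.init, ha] at hk
  · simp [AuctionState.init]
  · simp [AuctionState.init, ha] at hk

theorem LoopInv.iteration (hG : G.IsPolymatroidal) (hv : ∀ i, 0 < v i) (hε : 0 < ε)
    (hvε : ∀ i, ∃ a : ℕ, v i = a * ε) {s s' : AuctionState N m} (hs : LoopInv G v B ε s)
    (h : Iteration G v B ε s s') : LoopInv G v B ε s' := by
  obtain ⟨-, t, hL, rfl⟩ := h
  obtain ⟨ht, hr, hsell⟩ := hL.round hG hv hs.inv
  have hsell' : ∀ i, G.Sellable t.w (t.demand v B) {i} := fun i => hsell i (by simp)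
  obtain ⟨q, hq⟩ := hs.synced
  have hqt : Synced ε t q := by
    unfold Synced; rw [hr.l_eq, hr.c_eq]; exact hq
  have hct := hs.certified.round hv hε hvε hq ht hr
  exact ⟨ht.tick hε hsell' hqt.1, hqt.tick, hct.tick hv hε hvε hqt ht hsell'⟩

theorem loopInv_of_reachable (hG : G.IsPolymatroidal) (hN : 0 < N) (hv : ∀ i, 0 < v i)
    (hε : 0 < ε) (hvε : ∀ i, ∃ a : ℕ, v i = a * ε) {s : AuctionState N m}
    (h : Relation.ReflTransGen (Iteration G v B ε) init s) : LoopInv G v B ε s := by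
  induction h with
  | refl => exact LoopInv.init hG hN
  | tail _ h ih => exact ih.iteration hG hv hε hvε h

/-- The auction ends, because every pass through the main loop raises a clock. -/
theorem exists_terminal (hG : G.IsPolymatroidal) (hN : 0 < N) (hv : ∀ i, 0 < v i)
    (hε : 0 < ε) (hvε : ∀ i, ∃ a : ℕ, v i = a * ε) :
    ∃ s : AuctionState N m, IsTerminal G v B ε s := by
  by_contra! hno
  have key : ∀ τ : ℕ, ∃ s : AuctionState N m,
      Relation.ReflTransGen (Iteration G v B ε) init s ∧ ∑ i, s.c i = τ * ε := by
    intro τ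
    induction τ with
    | zero => exact ⟨init, .refl, by simp [init]⟩
    | succ τ ih =>
      obtain ⟨s, hs, hsum⟩ := ih
      have hinv := loopInv_of_reachable hG hN hv hε hvε hs
      have hne : ∃ i, s.demand v B i ≠ 0 := by
        by_contra! h0
        exact hno s ⟨hs, h0⟩
      obtain ⟨t, ht⟩ := exists_clinchList hG hv (List.finRange N) hinv.inv
      refine ⟨t.tick ε, hs.tail ⟨hne, t, ht, rfl⟩, ?_⟩
      obtain ⟨-, hr, -⟩ := ht.round hG hv hinv.inv
      obtain ⟨q, hq⟩ := hinv.synced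
      have h1 : ∀ i : Fin N, (t.tick ε).c i = s.c i + if i = ⟨s.l, hq.1⟩ then ε else 0 := by
        intro i
        simp only [tick, hr.c_eq, hr.l_eq, Fin.ext_iff]
        split_ifs <;> simp
      simp only [h1, Finset.sum_add_distrib, hsum, Finset.sum_ite_eq', Finset.mem_univ, if_true]
      push_cast; ring
  choose a ha using hvε
  obtain ⟨K, hK⟩ : ∃ K, ∀ k, a k ≤ K := ⟨∑ k, a k, fun k =>
    Finset.single_le_sum (fun _ _ => Nat.zero_le _) (Finset.mem_univ k)⟩
  obtain ⟨s, hs, hsum⟩ := key (N * (K + 1))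
  obtain ⟨q, hq⟩ := (loopInv_of_reachable hG hN hv hε (fun i => ⟨a i, ha i⟩) hs).synced
  have hup : ∑ i, s.c i ≤ N * ((q + 1) * ε) := by
    have : ∀ i ∈ Finset.univ, s.c i ≤ (q + 1) * ε := fun i _ => (hq.bounds hε i).2
    simpa using Finset.sum_le_card_nsmul _ _ _ this
  have hKq : (K : ℝ) ≤ q := by
    rw [hsum, ← mul_assoc, mul_le_mul_iff_left₀ hε] at hup
    push_cast at hup
    have := (mul_le_mul_iff_right₀ (by exact_mod_cast hN : (0 : ℝ) < N)).1 hup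
    linarith
  refine hno s ⟨hs, fun i => demand_eq_zero (hv i) ?_⟩
  refine le_trans ?_ (hq.bounds hε i).1
  have : (a i : ℝ) ≤ K := by exact_mod_cast hK i
  rw [ha i]
  exact mul_le_mul_of_nonneg_right (this.trans hKq) hε.le

theorem residual_eq_zero_of_terminal {s : AuctionState N m} (hs : Inv G v B s)
    (hd : ∀ i, s.demand v B i = 0) : G.residual s.w Finset.univ = 0 := by
  obtain ⟨u, hu, hsum⟩ := hs.sell
  rw [← hsum]
  refine Finset.sum_eq_zero fun k _ => ?_
  have := hu.2.1 k
  rw [hd k] at this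
  exact le_antisymm (by simpa using this) (hu.1 k)

/-- In a terminal state the weighted amounts are at least as large as for any other vector that
respects the supply and the budgets. -/
theorem sum_le_of_terminal (hG : G.IsPolymatroidal) (hN : 0 < N) (hv : ∀ i, 0 < v i)
    (hε : 0 < ε) (hvε : ∀ i, ∃ a : ℕ, v i = a * ε) {s : AuctionState N m}
    (hs : IsTerminal G v B ε s) {z : Fin N → ℝ}
    (hz : ∀ T, ∑ k ∈ T, z k ≤ G.totalF (fiber m T))
    (hzB : ∀ k, B k ≠ ⊤ → v k * z k ≤ (B k).toReal) :
    ∑ k, v k * z k ≤ ∑ k, v k * G.amount s.w k := by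
  obtain ⟨hreach, hd⟩ := hs
  have hinv := loopInv_of_reachable hG hN hv hε hvε hreach
  have hsold := residual_eq_zero_of_terminal hinv.inv hd
  set x : Fin N → ℝ := fun k => G.amount s.w k with hxdef
  set φ : Finset (Fin N) → ℝ := fun T => G.totalF (fiber m T) with hφdef
  obtain ⟨hw0, hwE, hwF⟩ := (mem_polytope_iff hG).1 hinv.inv.poly
  have hx0 : ∀ k, 0 ≤ x k := fun k => Finset.sum_nonneg fun e _ => hw0 e
  have hxφ : ∀ T, ∑ k ∈ T, x k ≤ φ T := fun T => by
    simp only [hxdef, sum_amount_eq hwE]; exact hwF _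
  have hφsub : ∀ S T, φ (S ∪ T) + φ (S ∩ T) ≤ φ S + φ T := fun S T => by
    have h1 : fiber m (S ∪ T) = fiber m S ∪ fiber m T := by ext; simp
    have h2 : fiber m (S ∩ T) = fiber m S ∩ fiber m T := by ext; simp
    simp only [hφdef, h1, h2]; exact totalF_submodular hG _ _
  have hφmono : ∀ S T, S ⊆ T → φ S ≤ φ T := fun S T h =>
    totalF_mono hG fun e he => mem_fiber.2 (h (mem_fiber.1 he))
  have hres : ∀ T, G.residual s.w (fiber m T) = φ T - ∑ k ∈ T, x k := fun T => by
    simp only [Market.residual, hxdef, hφdef, sum_amount_eq hwE]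
  -- the certifying sets are tight, and outside of them the budgets are exhausted
  have htight : ∀ k, 0 < x k → ∃ T, k ∉ T ∧ φ T ≤ ∑ i ∈ T, x i ∧
      ∀ i, i ∉ T → v k < v i → B i ≤ ENNReal.ofReal (s.p i) := by
    intro k hk
    obtain ⟨T, ⟨hkT, b, hb0, -, hb⟩, hor⟩ := hinv.certified k hk
    refine ⟨T, hkT, ?_, fun i hi hvi => ?_⟩
    · rw [hsold, hres] at hb
      have := Finset.sum_nonneg fun j (_ : j ∈ (insert k T)ᶜ) => hb0 j
      linarith
    · rcases hor with hall | ⟨-, h⟩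
      · exact budget_le_of_demand_eq_zero (hd i) ((hall i).trans_lt hvi)
      · exact h i hi hvi
  refine sum_mul_le_sum_mul_of_upper hε hvε fun t => ?_
  refine sum_le_sum_of_tight hφsub ?_ hxφ hz fun i hi => ?_
  · have : fiber m (∅ : Finset (Fin N)) = ∅ := by ext; simp
    simp only [hφdef, this, totalF_empty hG]
  · by_cases hex : B i ≤ ENNReal.ofReal (s.p i)
    · left
      have h1 : B i ≠ ⊤ := ne_top_of_le_ne_top ENNReal.ofReal_ne_top hex
      have h2 := (ENNReal.toReal_le_of_le_ofReal (hinv.inv.p_nonneg i) hex)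
      have h3 := hinv.inv.p_le i
      exact le_of_mul_le_mul_left ((hzB i h1).trans (h2.trans h3)) (hv i)
    · right
      simp only [Finset.mem_filter, Finset.mem_univ, true_and] at hi
      have key : ∀ S : Finset (Fin N), ∃ T, i ∈ T ∧ φ T ≤ ∑ k ∈ T, x k ∧
          ∀ k ∈ S, v k < t → 0 < x k → k ∉ T := by
        intro S
        induction S using Finset.induction_on with
        | empty =>
          refine ⟨Finset.univ, by simp, ?_, by simp⟩
          have h1 := hres Finset.univ
          have h2 : fiber m (Finset.univ : Finset (Fin N)) = Finset.univ := by ext; simp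
          rw [h2, hsold] at h1
          linarith
        | insert k S _ ih =>
          obtain ⟨T, hiT, hT, hS⟩ := ih
          by_cases hk : v k < t ∧ 0 < x k
          · obtain ⟨T', hkT', hT', hexh⟩ := htight k hk.2
            refine ⟨T ∩ T', ?_, ?_, fun j hj hjt hjx => ?_⟩
            · refine Finset.mem_inter.2 ⟨hiT, ?_⟩
              by_contra hiT'
              exact hex (hexh i hiT' (hk.1.trans_le hi))
            · have h1 := hφsub T T'
              have h2 := hxφ (T ∪ T')
              have h3 := Finset.sum_union_inter (f := x) (s₁ := T) (s₂ := T')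
              linarith
            · rw [Finset.mem_inter, not_and_or]
              rcases Finset.mem_insert.1 hj with rfl | hj
              exacts [Or.inr hkT', Or.inl (hS j hj hjt hjx)]
          · refine ⟨T, hiT, hT, fun j hj hjt hjx => ?_⟩
            rcases Finset.mem_insert.1 hj with rfl | hj
            exacts [absurd ⟨hjt, hjx⟩ hk, hS j hj hjt hjx]
      obtain ⟨T, hiT, hT, hS⟩ := key Finset.univ
      refine ⟨T.filter (fun k => t ≤ v k), Finset.filter_subset_filter _ (Finset.subset_univ _),
        by simp [hiT, hi], ?_⟩
      refine (hφmono _ _ (Finset.filter_subset _ _)).trans (hT.trans (le_of_eq ?_))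
      symm
      refine Finset.sum_subset (Finset.filter_subset _ _) fun k hkT hk => ?_
      simp only [Finset.mem_filter, not_and, not_le] at hk
      by_contra hne
      exact hS k (Finset.mem_univ k) (hk hkT) (lt_of_le_of_ne (hx0 k) (Ne.symm hne)) hkT

end AuctionState

/-! ### The greedy vector maximizes the weighted amounts -/

section Greedy

open Market

variable {N m : ℕ} {G : Market N m} {v : Fin N → ℝ} {B : Fin N → ℝ≥0∞}

theorem capAt_le_left (a : ℝ) (b : ℝ≥0∞) : capAt a b ≤ a := by
  unfold capAt; split_ifs
  exacts [le_rfl, min_le_left _ _]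

theorem capAt_le_right (a : ℝ) {b : ℝ≥0∞} (hb : b ≠ ⊤) : capAt a b ≤ b.toReal := by
  unfold capAt; rw [if_neg hb]; exact min_le_right _ _

theorem le_capAt {a c : ℝ} {b : ℝ≥0∞} (ha : c ≤ a) (hb : b ≠ ⊤ → c ≤ b.toReal) :
    c ≤ capAt a b := by
  unfold capAt; split_ifs with h
  exacts [ha, le_min ha (hb h)]

theorem capAt_eq_or (a : ℝ) (b : ℝ≥0∞) : capAt a b = a ∨ b ≠ ⊤ ∧ capAt a b = b.toReal := by
  unfold capAt; split_ifs with h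
  · exact Or.inl rfl
  · exact (min_choice _ _).imp id fun h' => ⟨h, h'⟩

theorem mem_higher {i k : Fin N} : k ∈ higher v i ↔ v i < v k ∨ (v k = v i ∧ k < i) := by
  simp [higher]

theorem greedy_le_sub {i : Fin N} {H : Finset (Fin N)} (hH : H ⊆ higher v i) :
    greedy G v B i ≤ G.totalF (fiber m (insert i H)) - ∑ k ∈ H, greedy G v B k := by
  rw [greedy_eq, ← totalF_edgesOf]
  exact (capAt_le_left _ _).trans (Finset.inf'_le _ (Finset.mem_powerset.2 hH))

/-- The constraint for `T` is among those imposed on the member of `T` that comes last in the greedy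
order. -/
theorem sum_greedy_le (hG : G.IsPolymatroidal) (T : Finset (Fin N)) :
    ∑ k ∈ T, greedy G v B k ≤ G.totalF (fiber m T) := by
  rcases T.eq_empty_or_nonempty with rfl | hT
  · have : fiber m (∅ : Finset (Fin N)) = ∅ := by ext; simp
    simp [this, totalF_empty hG]
  · obtain ⟨i, hi, hmax⟩ := T.exists_max_image (fun k => (higher v k).card) hT
    have h1 : T.erase i ⊆ higher v i := by
      intro k hk
      rw [Finset.mem_erase] at hk
      rw [mem_higher]
      by_contra hno
      have h2 : i ∈ higher v k := by
        rw [mem_higher]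
        push Not at hno
        rcases hno.1.lt_or_eq with h | h
        · exact Or.inl h
        · exact Or.inr ⟨h.symm, lt_of_le_of_ne (hno.2 h) (Ne.symm hk.1)⟩
      exact absurd (hmax k hk.2) (not_le.2 (higher_card_lt v h2))
    have h2 := greedy_le_sub (G := G) (B := B) h1
    rw [Finset.insert_erase hi] at h2
    rw [← Finset.add_sum_erase T _ hi]
    linarith

theorem greedy_nonneg (hG : G.IsPolymatroidal) (i : Fin N) : 0 ≤ greedy G v B i := by
  rw [greedy_eq]
  refine le_capAt (Finset.le_inf' _ _ fun H _ => ?_) fun _ => ENNReal.toReal_nonneg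
  have h1 := sum_greedy_le (v := v) (B := B) hG H
  have h2 : G.totalF (fiber m H) ≤ G.totalF (fiber m (insert i H)) :=
    totalF_mono hG fun e he => by
      rw [mem_fiber] at he ⊢; exact Finset.mem_insert_of_mem he
  rw [totalF_edgesOf]
  linarith

theorem toReal_div_ofReal {b : ℝ≥0∞} {a : ℝ} (ha : 0 < a) :
    (b / ENNReal.ofReal a).toReal = b.toReal / a := by
  rw [ENNReal.toReal_div, ENNReal.toReal_ofReal ha.le]

theorem mul_greedy_le (hv : ∀ i, 0 < v i) (i : Fin N) (hB : B i ≠ ⊤) :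
    v i * greedy G v B i ≤ (B i).toReal := by
  rw [greedy_eq, mul_comm, ← le_div_iff₀ (hv i), ← toReal_div_ofReal (hv i)]
  exact capAt_le_right _ (ENNReal.div_ne_top hB (by simpa using hv i))

theorem sum_le_sum_greedy (hG : G.IsPolymatroidal) (hv : ∀ i, 0 < v i) {ε : ℝ} (hε : 0 < ε)
    (hvε : ∀ i, ∃ a : ℕ, v i = a * ε) {z : Fin N → ℝ}
    (hz : ∀ T, ∑ k ∈ T, z k ≤ G.totalF (fiber m T))
    (hzB : ∀ k, B k ≠ ⊤ → v k * z k ≤ (B k).toReal) :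
    ∑ k, v k * z k ≤ ∑ k, v k * greedy G v B k := by
  refine sum_mul_le_sum_mul_of_upper hε hvε fun t => ?_
  refine sum_le_sum_of_tight (φ := fun T => G.totalF (fiber m T)) (fun S T => ?_) ?_
    (sum_greedy_le hG) hz fun i hi => ?_
  · have h1 : fiber m (S ∪ T) = fiber m S ∪ fiber m T := by ext; simp
    have h2 : fiber m (S ∩ T) = fiber m S ∩ fiber m T := by ext; simp
    simp only [h1, h2]; exact totalF_submodular hG _ _
  · have : fiber m (∅ : Finset (Fin N)) = ∅ := by ext; simp
    simp only [this, totalF_empty hG]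
  · simp only [Finset.mem_filter, Finset.mem_univ, true_and] at hi
    have heq := greedy_eq G v B i
    rcases capAt_eq_or ((higher v i).powerset.inf' ⟨∅, by simp⟩ (fun H =>
      G.totalF (G.edgesOf (insert i H)) - ∑ k ∈ H, greedy G v B k))
      (B i / ENNReal.ofReal (v i)) with h | ⟨htop, h⟩
    · right
      obtain ⟨H, hH, hinf⟩ := Finset.exists_mem_eq_inf' (s := (higher v i).powerset)
        ⟨∅, by simp⟩ (fun H =>
          G.totalF (G.edgesOf (insert i H)) - ∑ k ∈ H, greedy G v B k)
      rw [Finset.mem_powerset] at hH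
      rw [h, hinf, totalF_edgesOf] at heq
      refine ⟨insert i H, fun k hk => ?_, Finset.mem_insert_self _ _, ?_⟩
      · simp only [Finset.mem_filter, Finset.mem_univ, true_and]
        rcases Finset.mem_insert.1 hk with rfl | hk
        · exact hi
        · rcases mem_higher.1 (hH hk) with h' | h'
          · exact hi.trans h'.le
          · exact hi.trans h'.1.ge
      · have hiH : i ∉ H := fun h' => by simpa [mem_higher] using hH h'
        rw [Finset.sum_insert hiH]
        linarith
    · left
      have hB : B i ≠ ⊤ := fun h' =>
        htop (by rw [h', ENNReal.top_div_of_ne_top ENNReal.ofReal_ne_top])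
      rw [heq, h, toReal_div_ofReal (hv i), le_div_iff₀ (hv i), mul_comm]
      exact hzB i hB

/-- Amounts that respect the supply of every group of buyers can be realized. -/
theorem exists_mem_polytope_amount_eq (hG : G.IsPolymatroidal) {u : Fin N → ℝ}
    (hu : ∀ k, 0 ≤ u k) (huT : ∀ T, ∑ k ∈ T, u k ≤ G.totalF (fiber m T)) :
    ∃ w ∈ G.polytope, ∀ k, G.amount w k = u k := by
  obtain ⟨w, hw0, hwF, hwu⟩ := exists_split Prod.fst G.totalF (totalF_submodular hG)
    (totalF_empty hG) u hu fun T F hTF =>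
      (huT T).trans (totalF_mono hG fun e he => hTF e (mem_fiber.1 he))
  have hwE : ∀ e, e ∉ G.E → w e = 0 := fun e he => by
    have h1 := hwF {e}
    have h2 : ({e} : Finset (Fin N × Fin m)) ∩ G.E = ∅ := by simp [he]
    rw [← totalF_inter_edges, h2, totalF_empty hG, Finset.sum_singleton] at h1
    exact le_antisymm h1 (hw0 e)
  exact ⟨w, (mem_polytope_iff hG).2 ⟨hw0, hwE, hwF⟩, fun k => by rw [amount_eq hwE, hwu]⟩

end Greedy

/-! ### The market with virtual buyers -/

namespace Market

variable {n m : ℕ} {G : Market n m}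

/-- The edge of the modified market that corresponds to an edge of the original one. -/
def embed (e : Fin n × Fin m) : Fin (n + m) × Fin m := (Fin.castAdd m e.1, e.2)

theorem embed_injective : Function.Injective (embed : Fin n × Fin m → Fin (n + m) × Fin m) := by
  rintro ⟨a, b⟩ ⟨a', b'⟩ h
  simpa [embed] using h

/-- The edge between seller `j` and her virtual buyer. -/
def virtualEdge (n : ℕ) {m : ℕ} (j : Fin m) : Fin (n + m) × Fin m := (Fin.natAdd n j, j)

theorem embed_ne_virtualEdge (e : Fin n × Fin m) (j : Fin m) : embed e ≠ virtualEdge n j := by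
  intro h
  have h1 := congrArg (fun p => (p.1 : ℕ)) h
  simp only [embed, virtualEdge, Fin.val_castAdd, Fin.val_natAdd] at h1
  have := e.1.isLt
  omega

theorem mem_E_withVirtual {e : Fin (n + m) × Fin m} : e ∈ G.withVirtual.E ↔
    (∃ e' ∈ G.E, embed e' = e) ∨ ∃ j, virtualEdge n j = e := by
  simp [withVirtual, embed, virtualEdge]

theorem embed_mem_E_iff {e : Fin n × Fin m} : embed e ∈ G.withVirtual.E ↔ e ∈ G.E := by
  rw [mem_E_withVirtual]
  constructor
  · rintro (⟨e', he', h⟩ | ⟨j, h⟩)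
    · exact embed_injective h ▸ he'
    · exact absurd h.symm (embed_ne_virtualEdge e j)
  · exact fun h => Or.inl ⟨e, h, rfl⟩

theorem virtualEdge_mem_E (j : Fin m) : virtualEdge n j ∈ G.withVirtual.E :=
  mem_E_withVirtual.2 (Or.inr ⟨j, rfl⟩)

/-- The edges of the original market that correspond to elements of `F`. -/
def restrict (G : Market n m) (F : Finset (Fin (n + m) × Fin m)) : Finset (Fin n × Fin m) :=
  G.E.filter (fun e => embed e ∈ F)

theorem mem_restrict {F : Finset (Fin (n + m) × Fin m)} {e : Fin n × Fin m} :
    e ∈ G.restrict F ↔ e ∈ G.E ∧ embed e ∈ F := by simp [restrict]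

theorem f_withVirtual (j : Fin m) (F : Finset (Fin (n + m) × Fin m)) :
    G.withVirtual.f j F = if virtualEdge n j ∈ F then G.f j (G.sellerEdges j)
      else G.f j (G.restrict F) := rfl

theorem sellerEdges_withVirtual (j : Fin m) : G.withVirtual.sellerEdges j =
    insert (virtualEdge n j) ((G.sellerEdges j).map ⟨embed, embed_injective⟩) := by
  ext e
  simp only [sellerEdges, Finset.mem_filter, mem_E_withVirtual, Finset.mem_insert, Finset.mem_map,
    Function.Embedding.coeFn_mk]
  constructor
  · rintro ⟨⟨e', he', rfl⟩ | ⟨j', rfl⟩, rfl⟩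
    · exact Or.inr ⟨e', ⟨he', rfl⟩, rfl⟩
    · exact Or.inl rfl
  · rintro (rfl | ⟨e', ⟨he', rfl⟩, rfl⟩)
    · exact ⟨Or.inr ⟨j, rfl⟩, rfl⟩
    · exact ⟨Or.inl ⟨e', he', rfl⟩, rfl⟩

theorem virtualEdge_notMem_map (A : Finset (Fin n × Fin m)) (j : Fin m) :
    virtualEdge n j ∉ A.map ⟨embed, embed_injective⟩ := by
  simp only [Finset.mem_map, Function.Embedding.coeFn_mk, not_exists, not_and]
  exact fun e _ => embed_ne_virtualEdge e j

theorem restrict_subset_sellerEdges {F : Finset (Fin (n + m) × Fin m)} {j : Fin m}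
    (hF : F ⊆ G.withVirtual.sellerEdges j) : G.restrict F ⊆ G.sellerEdges j := by
  intro e he
  rw [mem_restrict] at he
  have := hF he.2
  simp only [sellerEdges, Finset.mem_filter] at this ⊢
  exact ⟨he.1, this.2⟩

theorem IsPolymatroidal.withVirtual (hG : G.IsPolymatroidal) :
    G.withVirtual.IsPolymatroidal := by
  refine ⟨fun j => ?_, fun j F F' hFF' hF' => ?_, fun j F F' hF hF' => ?_⟩
  · have : G.restrict ∅ = ∅ := by ext; simp [mem_restrict]
    simp [f_withVirtual, this, hG.empty]
  · have hR' := restrict_subset_sellerEdges hF'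
    have hR : G.restrict F ⊆ G.restrict F' := fun e he => by
      rw [mem_restrict] at he ⊢; exact ⟨he.1, hFF' he.2⟩
    simp only [f_withVirtual]
    by_cases h : virtualEdge n j ∈ F
    · simp [h, hFF' h]
    · by_cases h' : virtualEdge n j ∈ F'
      · simpa [h, h'] using hG.mono j _ _ (hR.trans hR') subset_rfl
      · simpa [h, h'] using hG.mono j _ _ hR hR'
  · have hR := restrict_subset_sellerEdges hF
    have hR' := restrict_subset_sellerEdges hF'
    have hu : G.restrict (F ∪ F') = G.restrict F ∪ G.restrict F' := by
      ext e; simp only [mem_restrict, Finset.mem_union]; tauto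
    have hi : G.restrict (F ∩ F') = G.restrict F ∩ G.restrict F' := by
      ext e; simp only [mem_restrict, Finset.mem_inter]; tauto
    simp only [f_withVirtual, Finset.mem_union, Finset.mem_inter, hu, hi]
    by_cases h : virtualEdge n j ∈ F <;> by_cases h' : virtualEdge n j ∈ F' <;>
      simp only [h, h', or_true, true_or, or_self, and_true, true_and, and_self, if_true, if_false]
    · exact le_rfl
    · linarith [hG.mono j _ _ (Finset.inter_subset_right (s₁ := G.restrict F)) hR']
    · linarith [hG.mono j _ _ (Finset.inter_subset_left (s₂ := G.restrict F')) hR]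
    · exact hG.submodular j _ _ hR hR'

theorem f_sellerEdges_withVirtual (j : Fin m) :
    G.withVirtual.f j (G.withVirtual.sellerEdges j) = G.f j (G.sellerEdges j) := by
  rw [f_withVirtual, if_pos]
  rw [sellerEdges_withVirtual]; exact Finset.mem_insert_self _ _

theorem amount_castAdd (y : Fin (n + m) × Fin m → ℝ) (i : Fin n) :
    G.withVirtual.amount y (Fin.castAdd m i) = G.amount (fun e => y (embed e)) i := by
  have : G.withVirtual.buyerEdges (Fin.castAdd m i) =
      (G.buyerEdges i).map ⟨embed, embed_injective⟩ := by
    ext e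
    simp only [buyerEdges, Finset.mem_filter, mem_E_withVirtual, Finset.mem_map,
      Function.Embedding.coeFn_mk]
    constructor
    · rintro ⟨⟨e', he', rfl⟩ | ⟨j, rfl⟩, h⟩
      · exact ⟨e', ⟨he', by simpa [embed] using h⟩, rfl⟩
      · simp only [virtualEdge, Fin.ext_iff, Fin.val_natAdd, Fin.val_castAdd] at h
        have := i.isLt
        omega
    · rintro ⟨e', ⟨he', rfl⟩, rfl⟩
      exact ⟨Or.inl ⟨e', he', rfl⟩, rfl⟩
  simp only [amount, this, Finset.sum_map, Function.Embedding.coeFn_mk]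

theorem amount_natAdd (y : Fin (n + m) × Fin m → ℝ) (j : Fin m) :
    G.withVirtual.amount y (Fin.natAdd n j) = y (virtualEdge n j) := by
  have : G.withVirtual.buyerEdges (Fin.natAdd n j) = {virtualEdge n j} := by
    ext e
    simp only [buyerEdges, Finset.mem_filter, mem_E_withVirtual, Finset.mem_singleton]
    constructor
    · rintro ⟨⟨e', he', rfl⟩ | ⟨j', rfl⟩, h⟩
      · simp only [embed, Fin.ext_iff, Fin.val_natAdd, Fin.val_castAdd] at h
        have := e'.1.isLt
        omega
      · have : j' = j := by simpa [virtualEdge] using h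
        rw [this]
    · rintro rfl
      exact ⟨Or.inr ⟨j, rfl⟩, rfl⟩
  simp [amount, this]

theorem sum_sellerEdges_withVirtual (y : Fin (n + m) × Fin m → ℝ) (j : Fin m) :
    ∑ e ∈ G.withVirtual.sellerEdges j, y e =
      y (virtualEdge n j) + ∑ e ∈ G.sellerEdges j, y (embed e) := by
  rw [sellerEdges_withVirtual, Finset.sum_insert (virtualEdge_notMem_map _ j), Finset.sum_map]
  rfl

theorem comp_embed_mem_polytope {w : Fin (n + m) × Fin m → ℝ}
    (hw : w ∈ G.withVirtual.polytope) : (fun e => w (embed e)) ∈ G.polytope := by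
  obtain ⟨h0, hE, hF⟩ := hw
  refine ⟨fun e => h0 _, fun e he => hE _ (by rwa [embed_mem_E_iff]), fun j F hFj => ?_⟩
  have h1 := hF j (F.map ⟨embed, embed_injective⟩) (by
    rw [sellerEdges_withVirtual]
    exact (Finset.map_subset_map.2 hFj).trans (Finset.subset_insert _ _))
  rw [Finset.sum_map, f_withVirtual, if_neg (virtualEdge_notMem_map _ j)] at h1
  have h2 : G.restrict (F.map ⟨embed, embed_injective⟩) = F := by
    ext e
    rw [mem_restrict]
    constructor
    · rintro ⟨-, h⟩
      obtain ⟨e', he', h'⟩ := Finset.mem_map.1 h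
      exact embed_injective h' ▸ he'
    · exact fun h => ⟨(Finset.mem_filter.1 (hFj h)).1, Finset.mem_map_of_mem _ h⟩
  rwa [h2] at h1

theorem le_unsold {w : Fin (n + m) × Fin m → ℝ} (hw : w ∈ G.withVirtual.polytope) (j : Fin m) :
    w (virtualEdge n j) ≤ G.unsold (fun e => w (embed e)) j := by
  have := hw.2.2 j _ subset_rfl
  rw [f_sellerEdges_withVirtual, sum_sellerEdges_withVirtual] at this
  unfold unsold; linarith

/-- The transactions of the modified market in which the virtual buyers buy all unsold goods. -/
def extend (G : Market n m) (w : Fin n × Fin m → ℝ) (e : Fin (n + m) × Fin m) : ℝ :=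
  Fin.addCases (motive := fun _ => ℝ) (fun i => w (i, e.2))
    (fun j => if j = e.2 then G.unsold w j else 0) e.1

theorem extend_embed (w : Fin n × Fin m → ℝ) (e : Fin n × Fin m) :
    G.extend w (embed e) = w e := by simp [extend, embed]

theorem extend_virtualEdge (w : Fin n × Fin m → ℝ) (j : Fin m) :
    G.extend w (virtualEdge n j) = G.unsold w j := by simp [extend, virtualEdge]

theorem extend_mem_polytope {w : Fin n × Fin m → ℝ} (hw : w ∈ G.polytope) :
    G.extend w ∈ G.withVirtual.polytope := by
  obtain ⟨h0, hE, hF⟩ := hw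
  have hun : ∀ j, 0 ≤ G.unsold w j := fun j => sub_nonneg.2 (hF j _ subset_rfl)
  have h0' : ∀ e, 0 ≤ G.extend w e := by
    rintro ⟨a, b⟩
    refine Fin.addCases (fun i => ?_) (fun j => ?_) a
    · simpa [extend] using h0 (i, b)
    · simp only [extend, Fin.addCases_right]
      split_ifs
      exacts [hun j, le_rfl]
  refine ⟨h0', ?_, fun j F hFj => ?_⟩
  · rintro ⟨a, b⟩
    refine Fin.addCases (fun i he => ?_) (fun j he => ?_) a
    · have : (i, b) ∉ G.E := fun h => he (embed_mem_E_iff.2 h)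
      simpa [extend] using hE _ this
    · have : j ≠ b := by
        rintro rfl
        exact he (virtualEdge_mem_E j)
      simp [extend, this]
  · rw [f_withVirtual]
    split_ifs with hv
    · refine (Finset.sum_le_sum_of_subset_of_nonneg hFj fun e _ _ => h0' e).trans (le_of_eq ?_)
      rw [sum_sellerEdges_withVirtual, extend_virtualEdge]
      simp only [extend_embed, unsold]
      ring
    · have h1 : F = (G.restrict F).map ⟨embed, embed_injective⟩ := by
        ext e
        rw [Finset.mem_map]
        constructor
        · intro he
          have h2 := hFj he
          rw [sellerEdges_withVirtual, Finset.mem_insert, Finset.mem_map] at h2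
          rcases h2 with rfl | ⟨e', he', rfl⟩
          · exact absurd he hv
          · exact ⟨e', mem_restrict.2 ⟨(Finset.mem_filter.1 he').1, he⟩, rfl⟩
        · rintro ⟨e', he', rfl⟩
          exact (mem_restrict.1 he').2
      have h2 := hF j _ (restrict_subset_sellerEdges hFj)
      have h3 : ∑ e ∈ F, G.extend w e = ∑ e ∈ G.restrict F, w e := by
        conv_lhs => rw [h1]
        rw [Finset.sum_map]
        exact Finset.sum_congr rfl fun e _ => extend_embed w e
      rw [h3]; exact h2

end Market

/-! ### Optimal liquid welfare and the welfare of the mechanism -/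

section Welfare

open Market

variable {n m : ℕ} {G : Market n m} {v : Fin n → ℝ} {ρ : Fin m → ℝ} {B : Fin n → ℝ≥0∞} {ε : ℝ}

theorem extVal_pos (hv : ∀ i, 0 < v i) (hρ : ∀ j, 0 < ρ j) (k : Fin (n + m)) :
    0 < extVal v ρ k := by
  refine Fin.addCases (fun i => ?_) (fun j => ?_) k
  · simpa [extVal] using hv i
  · simpa [extVal] using hρ j

theorem extVal_multiple (hvε : ∀ i, ∃ k : ℕ, v i = k * ε) (hρε : ∀ j, ∃ k : ℕ, ρ j = k * ε)
    (k : Fin (n + m)) : ∃ a : ℕ, extVal v ρ k = a * ε := by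
  refine Fin.addCases (fun i => ?_) (fun j => ?_) k
  · simpa [extVal] using hvε i
  · simpa [extVal] using hρε j

theorem sum_extVal_mul (x : Fin (n + m) → ℝ) : ∑ k, extVal v ρ k * x k =
    ∑ i, v i * x (Fin.castAdd m i) + ∑ j, ρ j * x (Fin.natAdd n j) := by
  rw [Fin.sum_univ_add]
  simp [extVal]

/-- An allocation yields a vector of the modified market by capping the amounts of the buyers at
their budgets and letting the virtual buyers buy the unsold goods. -/
theorem liquidWelfare_le (hG : G.IsPolymatroidal) (hv : ∀ i, 0 < v i) (hρ : ∀ j, 0 < ρ j)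
    (hε : 0 < ε) (hvε : ∀ i, ∃ k : ℕ, v i = k * ε) (hρε : ∀ j, ∃ k : ℕ, ρ j = k * ε)
    {A : Allocation n m} (hA : A.IsFeasible G B) : liquidWelfare G v ρ B A ≤
      ∑ k, extVal v ρ k * greedy G.withVirtual (extVal v ρ) (extBudget m B) k := by
  have hG' := hG.withVirtual
  have hw := extend_mem_polytope hA.1
  obtain ⟨hw0, hwE, hwF⟩ := (mem_polytope_iff hG').1 hw
  set z : Fin (n + m) → ℝ := fun k => Fin.addCases (motive := fun _ => ℝ)
    (fun i => capAt (v i * G.amount A.w i) (B i) / v i) (fun j => G.unsold A.w j) k with hz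
  have hzl : ∀ i, z (Fin.castAdd m i) = capAt (v i * G.amount A.w i) (B i) / v i := fun i => by
    simp [hz]
  have hzr : ∀ j, z (Fin.natAdd n j) = G.unsold A.w j := fun j => by simp [hz]
  have hzw : ∀ k, z k ≤ G.withVirtual.amount (G.extend A.w) k := fun k => by
    refine Fin.addCases (fun i => ?_) (fun j => ?_) k
    · rw [hzl, amount_castAdd, div_le_iff₀ (hv i), mul_comm]
      simp only [extend_embed]
      exact capAt_le_left _ _
    · rw [hzr, amount_natAdd, extend_virtualEdge]
  have hLW : liquidWelfare G v ρ B A = ∑ k, extVal v ρ k * z k := by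
    rw [sum_extVal_mul]
    simp only [hzl, hzr, liquidWelfare]
    congr 1
    exact Finset.sum_congr rfl fun i _ => (mul_div_cancel₀ _ (hv i).ne').symm
  rw [hLW]
  refine sum_le_sum_greedy hG' (extVal_pos hv hρ) hε (extVal_multiple hvε hρε) (fun T => ?_)
    fun k => ?_
  · refine (Finset.sum_le_sum fun k _ => hzw k).trans ?_
    rw [sum_amount_eq hwE]
    exact hwF _
  · refine Fin.addCases (fun i hi => ?_) (fun j hj => ?_) k
    · simp only [extBudget, Fin.append_left] at hi ⊢
      rw [hzl, extVal, Fin.append_left, mul_div_cancel₀ _ (hv i).ne']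
      exact capAt_le_right _ hi
    · simp [extBudget] at hj

/-- The greedy vector is realized by transactions of the modified market; canceling those of the
virtual buyers leaves at least as much unsold as the virtual buyers obtained. -/
theorem exists_liquidWelfare_eq (hG : G.IsPolymatroidal) (hv : ∀ i, 0 < v i) (hρ : ∀ j, 0 < ρ j)
    (hε : 0 < ε) (hvε : ∀ i, ∃ k : ℕ, v i = k * ε) (hρε : ∀ j, ∃ k : ℕ, ρ j = k * ε) :
    ∃ A : Allocation n m, A.IsFeasible G B ∧
      ∑ k, extVal v ρ k * greedy G.withVirtual (extVal v ρ) (extBudget m B) k =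
        liquidWelfare G v ρ B A := by
  have hG' := hG.withVirtual
  set x := greedy G.withVirtual (extVal v ρ) (extBudget m B) with hx
  obtain ⟨w, hw, hwx⟩ := exists_mem_polytope_amount_eq hG' (u := x) (greedy_nonneg hG')
    (sum_greedy_le hG')
  have hA : Allocation.IsFeasible G B ⟨fun e => w (embed e), 0, 0⟩ :=
    ⟨comp_embed_mem_polytope hw, by simp, by simp⟩
  refine ⟨_, hA, le_antisymm ?_ (liquidWelfare_le hG hv hρ hε hvε hρε hA)⟩
  rw [sum_extVal_mul]
  refine add_le_add (Finset.sum_le_sum fun i _ => ?_) (Finset.sum_le_sum fun j _ => ?_)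
  · rw [← amount_castAdd, hwx]
    refine le_capAt le_rfl fun hB => ?_
    have h := mul_greedy_le (G := G.withVirtual) (B := extBudget m B) (extVal_pos hv hρ)
      (Fin.castAdd m i) (by simpa [extBudget] using hB)
    rw [← hx] at h
    simpa [extVal, extBudget] using h
  · refine mul_le_mul_of_nonneg_left ?_ (hρ j).le
    rw [← hwx, amount_natAdd]
    exact le_unsold hw j

/-- Once all goods of the modified market are sold, the virtual buyer of a seller holds exactly what
is unsold in the original market. -/
theorem socialWelfare_output {s : AuctionState (n + m) m}
    (hw : s.w ∈ G.withVirtual.polytope) (hsold : G.withVirtual.residual s.w Finset.univ = 0) :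
    socialWelfare G v ρ s.output = ∑ k, extVal v ρ k * G.withVirtual.amount s.w k := by
  have h1 : ∀ j ∈ Finset.univ, 0 ≤ G.withVirtual.f j (G.withVirtual.sellerEdges j) -
      ∑ e ∈ G.withVirtual.sellerEdges j, s.w e :=
    fun j _ => sub_nonneg.2 (hw.2.2 j _ subset_rfl)
  rw [Market.residual, totalF, sum_eq_sum_sellerEdges hw.2.1, ← Finset.sum_sub_distrib] at hsold
  simp only [Finset.univ_inter] at hsold
  rw [Finset.sum_eq_zero_iff_of_nonneg h1] at hsold
  rw [sum_extVal_mul, socialWelfare]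
  congr 1
  · refine Finset.sum_congr rfl fun i _ => ?_
    rw [amount_castAdd]; rfl
  · refine Finset.sum_congr rfl fun j hj => ?_
    have h2 := hsold j hj
    rw [f_sellerEdges_withVirtual, sum_sellerEdges_withVirtual] at h2
    rw [amount_natAdd]
    congr 1
    have h3 : s.output.w = fun e => s.w (embed e) := rfl
    rw [unsold, h3]
    linarith

end Welfare

end

theorem theorem3p10 {n m : ℕ} (hn : 0 < n) (hm : 0 < m)
    (G : Market n m) (hG : G.IsPolymatroidal)
    (v : Fin n → ℝ) (ρ : Fin m → ℝ) (B : Fin n → ℝ≥0∞)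
    (hv : ∀ i, 0 < v i) (hρ : ∀ j, 0 < ρ j)
    (ε : ℝ) (hε : 0 < ε)
    (hvε : ∀ i, ∃ k : ℕ, v i = k * ε) (hρε : ∀ j, ∃ k : ℕ, ρ j = k * ε) :
    -- the mechanism has an outcome
    (∃ s, IsPCATerminal G v ρ B ε s) ∧
    -- `∑ v_i x*_i` is the optimal liquid welfare
    IsGreatest {L : ℝ | ∃ A : Allocation n m, A.IsFeasible G B ∧ L = liquidWelfare G v ρ B A}
      (∑ i, extVal v ρ i * greedy G.withVirtual (extVal v ρ) (extBudget m B) i) ∧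
    -- the inequality, for every outcome
    ∀ s, IsPCATerminal G v ρ B ε s →
      socialWelfare G v ρ s.output = ∑ i, extVal v ρ i * G.withVirtual.amount s.w i ∧
      ∑ i, extVal v ρ i * greedy G.withVirtual (extVal v ρ) (extBudget m B) i ≤
        ∑ i, extVal v ρ i * G.withVirtual.amount s.w i := by
  have hN : 0 < n + m := by omega
  have hG' := hG.withVirtual
  have hv' := extVal_pos hv hρ
  have hvε' := extVal_multiple hvε hρε
  refine ⟨AuctionState.exists_terminal hG' hN hv' hε hvε',
    ⟨exists_liquidWelfare_eq hG hv hρ hε hvε hρε, ?_⟩, fun s hs => ⟨?_, ?_⟩⟩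
  · rintro _ ⟨A, hA, rfl⟩
    exact liquidWelfare_le hG hv hρ hε hvε hρε hA
  · have hinv := (AuctionState.loopInv_of_reachable hG' hN hv' hε hvε' hs.1).inv
    exact socialWelfare_output hinv.poly (AuctionState.residual_eq_zero_of_terminal hinv hs.2)
  · exact AuctionState.sum_le_of_terminal hG' hN hv' hε hvε' hs (sum_greedy_le hG')
      (fun k hk => mul_greedy_le hv' k hk)
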